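/- Consider a $2\times2$ system $u_t+(f(u))_x=0$, $t>0$, $x\in\mathbb R$, with values in a bounded set $\mathcal V_0\subset\mathbb R^2$ with interior $\mathcal V$, where $f:\mathcal V_0\to\mathbb R^2$ is continuous and bounded, and $C^4$ on $\mathcal V$. Assume: (a) for $u\in\mathcal V$, $f'(u)$ has real eigenvalues $\lambda_1(u)<\lambda_2(u)$; (b) $\lambda_i'(u)\cdot r\ne0$ for every $u\in\mathcal V$, $i=1,2$ and every right eigenvector $r$ of $f'(u)$ for $\lambda_i(u)$; (c) $\mathcal V_0$ is convex, $\eta:\mathcal V_0\to\mathbb R$ is strictly convex, and $\eta,q:\mathcal V_0\to\mathbb R$ are continuous and bounded, $C^3$ on $\mathcal V$, with $q'=\eta'f'$ on $\mathcal V$; (d) for every $b\in\mathcal V$ and every left eigenvector $\ell$ of $f'(b)$, the function $u\mapsto\ell\cdot f(u)$ is either convex or concave on $\mathcal V$; (e) there is $L>0$ with $|\lambda_i(u)|\le L$ for all $u\in\mathcal V$, $i=1,2$. For $a\in\mathcal V_0$, $b\in\mathcal V$ put $\eta(a|b)=\eta(a)-\eta(b)-\eta'(b)(a-b)$ and $q(a;b)=q(a)-q(b)-\eta'(b)(f(a)-f(b))$.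 A function $u\in L^\infty(\mathbb R^+\times\mathbb R)$ has strong traces $u_\pm=u(\cdot,X(\cdot)\pm)\in L^\infty(\mathbb R^+)$ along a curve $x=X(t)$ if for every $T>0$ $$\lim_{n\to\infty}\int_0^T\operatorname*{ess\,sup}_{0<y<1/n}|u(t,X(t)+y)-u_+(t)|\,dt=\lim_{n\to\infty}\int_0^T\operatorname*{ess\,sup}_{-1/n<y<0}|u(t,X(t)+y)-u_-(t)|\,dt=0 .$$ Let $\mathcal S_{weak}$ be the set of measurable $u:\mathbb R^+\times\mathbb R\to\mathcal V_0$ that have strong traces along every Lipschitz curve $X:[0,\infty)\to\mathbb R$ and for which there is a measurable $u^0:\mathbb R\to\mathcal V_0$ such that, for all $\phi\in C_c^\infty([0,\infty)\times\mathbb R)$, $$\int_0^\infty\!\!\int_{\mathbb R}\big[\phi_t\,u+\phi_x f(u)\big]dx\,dt+\int_{\mathbb R}\phi(0,x)u^0(x)\,dx=0,$$ and, if in addition $\phi\ge0$, $$\int_0^\infty\!\!\int_{\mathbb R}\big[\phi_t\,\eta(u)+\phi_x q(u)\big]dx\,dt+\int_{\mathbb R}\phi(0,x)\eta(u^0(x))\,dx\ge0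 .$$ Let $v_L<v_R$ and let $\bar u(x/t)$, $v_L\le x/t\le v_R$, be a rarefaction wave of the $i$-th family, that is, $\bar u:[v_L,v_R]\to\mathcal V$ is $C^1$, and for every $y\in[v_L,v_R]$ the vector $\bar u'(y)$ is a right eigenvector of $f'(\bar u(y))$ for the eigenvalue $\lambda_i(\bar u(y))$, and $\lambda_i(\bar u(y))=y$. Then for every $u\in\mathcal S_{weak}$ whose traces $u(t,v_Lt+)$ and $u(t,v_Rt-)$ lie in $\mathcal V_0$ for almost every $t>0$, the function $x\mapsto\eta(u(t,x)|\bar u(x/t))$ is integrable on $(v_Lt,v_Rt)$ for almost every $t>0$, and $$\begin{aligned}\frac{d}{dt}\int_{v_Lt}^{v_Rt}\eta\big(u(t,x)|\bar u(x/t)\big)\,dx\le{}& q\big(u(t,v_Lt+);\bar u(v_L)\big)-q\big(u(t,v_Rt-);\bar u(v_R)\big)\\&-v_L\,\eta\big(u(t,v_Lt+)|\bar u(v_L)\big)+v_R\,\eta\big(u(t,v_Rt-)|\bar u(v_R)\big)\end{aligned}$$ in the sense of distributions on $(0,\infty)$, both the integral on the left and the right-hand side being locally integrable functions of $t\in(0,\infty)$.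 -/

import Mathlib

open MeasureTheory Set Filter Topology
open scoped ContDiff ENNReal NNReal

noncomputable section

namespace ConsLaw

/-- The plane `ℝ²`, with its Euclidean norm, in which the unknown takes its values. -/
abbrev State := EuclideanSpace ℝ (Fin 2)

/-- Structural assumptions on a `2 × 2` system `u_t + f(u)_x = 0` with set of states `V0`,
entropy `η`, entropy flux `q` and characteristic speeds `lam 0`, `lam 1`. The functions are total
in Lean, but only their values on `V0` (for `lam`: on the interior of `V0`) matter.
The convexity of `V0` is contained in `strictConvex`. -/
structure System (V0 : Set State) (f : State → State) (η q : State → ℝ)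
    (lam : Fin 2 → State → ℝ) : Prop where
  bounded : Bornology.IsBounded V0
  flux_continuous : ContinuousOn f V0
  flux_bounded : Bornology.IsBounded (f '' V0)
  flux_smooth : ContDiffOn ℝ 4 f (interior V0)
  /-- `lam i u` are eigenvalues of the Jacobian `f'(u)`. -/
  eigenvalue : ∀ u ∈ interior V0, ∀ i,
    Module.End.HasEigenvalue (fderiv ℝ f u : State →ₗ[ℝ] State) (lam i u)
  /-- Strict hyperbolicity. -/
  hyperbolic : ∀ u ∈ interior V0, lam 0 u < lam 1 u
  /-- Genuine nonlinearity of both fields. -/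
  genuinelyNonlinear : ∀ u ∈ interior V0, ∀ i, ∀ r : State,
    Module.End.HasEigenvector (fderiv ℝ f u : State →ₗ[ℝ] State) (lam i u) r →
      fderiv ℝ (lam i) u r ≠ 0
  entropy_continuous : ContinuousOn η V0
  entropy_bounded : Bornology.IsBounded (η '' V0)
  entropy_smooth : ContDiffOn ℝ 3 η (interior V0)
  strictConvex : StrictConvexOn ℝ V0 η
  entropyFlux_continuous : ContinuousOn q V0
  entropyFlux_bounded : Bornology.IsBounded (q '' V0)
  entropyFlux_smooth : ContDiffOn ℝ 3 q (interior V0)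
  /-- The compatibility relation `q' = η' f'`. -/
  compatible : ∀ u ∈ interior V0, fderiv ℝ q u = (fderiv ℝ η u).comp (fderiv ℝ f u)
  /-- For every left eigenvector `ℓ` of some `f'(b)` (a nonzero row vector, that is, a linear form,
  with `ℓ f'(b) = μ ℓ`), the function `ℓ · f` is convex or concave. -/
  leftEigenvector : ∀ b ∈ interior V0, ∀ (ℓ : State →L[ℝ] ℝ) (μ : ℝ), ℓ ≠ 0 →
    ℓ.comp (fderiv ℝ f b) = μ • ℓ →
      ConvexOn ℝ (interior V0) (fun u => ℓ (f u)) ∨ ConcaveOn ℝ (interior V0) (fun u => ℓ (f u))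
  /-- The characteristic speeds are bounded. -/
  speed_bounded : ∃ L : ℝ, 0 < L ∧ ∀ u ∈ interior V0, ∀ i, |lam i u| ≤ L

/-- The relative entropy `η(a|b) = η(a) - η(b) - η'(b)(a - b)`. -/
def relEntropy (η : State → ℝ) (a b : State) : ℝ :=
  η a - η b - fderiv ℝ η b (a - b)

/-- The relative entropy flux `q(a;b) = q(a) - q(b) - η'(b)(f(a) - f(b))`. -/
def relFlux (f : State → State) (η q : State → ℝ) (a b : State) : ℝ :=
  q a - q b - fderiv ℝ η b (f a - f b)

/-- `w(t) = u(t, X(t)+)`, the strong trace of `u` from the right along the curve `x = X(t)`. -/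
def IsRightTrace (u : ℝ → ℝ → State) (X : ℝ → ℝ) (w : ℝ → State) : Prop :=
  MemLp w ⊤ (volume.restrict (Ioi 0)) ∧
  ∀ T : ℝ, 0 < T → Tendsto (fun n : ℕ => ∫⁻ t in Ioo 0 T,
    essSup (fun y => ‖u t (X t + y) - w t‖ₑ) (volume.restrict (Ioo 0 (1 / (n : ℝ)))))
    atTop (𝓝 0)

/-- `w(t) = u(t, X(t)-)`, the strong trace of `u` from the left along the curve `x = X(t)`. -/
def IsLeftTrace (u : ℝ → ℝ → State) (X : ℝ → ℝ) (w : ℝ → State) : Prop :=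
  MemLp w ⊤ (volume.restrict (Ioi 0)) ∧
  ∀ T : ℝ, 0 < T → Tendsto (fun n : ℕ => ∫⁻ t in Ioo 0 T,
    essSup (fun y => ‖u t (X t + y) - w t‖ₑ) (volume.restrict (Ioo (-(1 / (n : ℝ))) 0)))
    atTop (𝓝 0)

/-- The strong trace property: strong traces exist along every Lipschitz curve. -/
def StrongTraceProperty (u : ℝ → ℝ → State) : Prop :=
  ∀ X : ℝ → ℝ, (∃ K : ℝ≥0, LipschitzOnWith K X (Ici 0)) →
    (∃ w, IsRightTrace u X w) ∧ (∃ w, IsLeftTrace u X w)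

/-- The open half plane `t > 0` of points `(t, x)`. -/
def halfPlane : Set (ℝ × ℝ) := Ioi 0 ×ˢ univ

/-- `u` is a weak solution of `u_t + f(u)_x = 0` on `t > 0` with initial value `u0`. The test
functions are the restrictions to `t ≥ 0` of smooth compactly supported functions on the plane. -/
def IsWeakSolution (f : State → State) (u : ℝ → ℝ → State) (u0 : ℝ → State) : Prop :=
  ∀ φ : ℝ × ℝ → ℝ, ContDiff ℝ ∞ φ → HasCompactSupport φ →
    (∫ p in halfPlane, (fderiv ℝ φ p (1, 0) • u p.1 p.2 + fderiv ℝ φ p (0, 1) • f (u p.1 p.2)))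
      + (∫ x, φ (0, x) • u0 x) = 0

/-- `u` satisfies `η(u)_t + q(u)_x ≤ 0` on `t > 0` in the weak sense, with initial value `u0`. -/
def IsEntropic (η q : State → ℝ) (u : ℝ → ℝ → State) (u0 : ℝ → State) : Prop :=
  ∀ φ : ℝ × ℝ → ℝ, ContDiff ℝ ∞ φ → HasCompactSupport φ → (∀ p, 0 ≤ φ p) →
    0 ≤ (∫ p in halfPlane,
        (fderiv ℝ φ p (1, 0) * η (u p.1 p.2) + fderiv ℝ φ p (0, 1) * q (u p.1 p.2)))
      + (∫ x, φ (0, x) * η (u0 x))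

/-- The class of wild solutions: measurable functions on `t > 0` with values in `V0` almost
everywhere (hence bounded when `V0` is) that are entropic weak solutions for some initial value,
and that have the strong trace property. -/
def weakSolutions (V0 : Set State) (f : State → State) (η q : State → ℝ) :
    Set (ℝ → ℝ → State) :=
  {u | AEStronglyMeasurable (Function.uncurry u) (volume.restrict halfPlane) ∧
    (∀ᵐ p ∂(volume.restrict halfPlane), u p.1 p.2 ∈ V0) ∧
    (∃ u0 : ℝ → State, AEStronglyMeasurable u0 volume ∧ (∀ᵐ x, u0 x ∈ V0) ∧
      IsWeakSolution f u u0 ∧ IsEntropic η q u u0) ∧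
    StrongTraceProperty u}

/-- The profile `y ↦ ubar y`, `vL ≤ y ≤ vR`, of a (nontrivial) rarefaction wave `ubar (x / t)` of
the `i`-th family: a `C¹` curve in the interior of `V0` whose velocity is a right eigenvector of
`f'` of the `i`-th family, parametrized by the characteristic speed. -/
structure IsRarefaction (V0 : Set State) (f : State → State) (lam : Fin 2 → State → ℝ)
    (i : Fin 2) (vL vR : ℝ) (ubar : ℝ → State) : Prop where
  lt : vL < vR
  smooth : ContDiffOn ℝ 1 ubar (Icc vL vR)
  mem : ∀ y ∈ Icc vL vR, ubar y ∈ interior V0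
  eigenvector : ∀ y ∈ Icc vL vR,
    Module.End.HasEigenvector (fderiv ℝ f (ubar y) : State →ₗ[ℝ] State) (lam i (ubar y))
      (derivWithin ubar (Icc vL vR) y)
  speed : ∀ y ∈ Icc vL vR, lam i (ubar y) = y

/-- `dE/dt ≤ B` in the sense of distributions on `(0, ∞)`, both sides being locally integrable. -/
def DistribDerivLE (E B : ℝ → ℝ) : Prop :=
  LocallyIntegrableOn E (Ioi 0) ∧ LocallyIntegrableOn B (Ioi 0) ∧
  ∀ φ : ℝ → ℝ, ContDiff ℝ ∞ φ → HasCompactSupport φ → tsupport φ ⊆ Ioi 0 → (∀ t, 0 ≤ φ t) →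
    -(∫ t, deriv φ t * E t) ≤ (∫ t, φ t * B t)

end ConsLaw

end

/-! The argument is Dafermos' relative entropy method, carried out with self-similar test functions
`φ(t) g(x/t)`, where `g ≥ 0` is smooth and supported inside the fan. Write `b` for the profile and
`y = x/t`. From the entropy inequality for `u` subtract the weak equation tested by `φ g η'(b)` and
an exact identity for the profile itself. What remains is the inequality for `η(u|b)` with flux
`q(u;b) - y η(u|b)`, except for a source term: `φ g / t` times `ℓ (f(u) - f(b) - y (u - b))`, where
`ℓ = η''(b) b'`.

The heart of the matter is the sign of this source (`IsFanCurve.source_nonneg`). Differentiating `q'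
= η' f'` shows that `η''` symmetrizes `f'`, so `ℓ` is a left eigenvector of `f'(b)` for the
eigenvalue `y`, unless it vanishes. Hence `ℓ · f` is convex or concave. Since `ℓ(b') > 0` and the
speed increases along the wave, the rarefaction curve itself lies strictly on the convex side of the
tangent plane, which rules out concavity. Convexity is exactly nonnegativity of the source, so the
source may be dropped (`IsFanCurve.relEntropy_inequality`).

It remains to let `g` increase to the indicator of `(vL, vR)`. Dominated convergence yields the
integral over the fan. The derivative of `g` concentrates at the two edges, on their inner sides,
and the strong traces identify the limit (`HasMeanTrace.tendsto_integral`): convergence in mean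
gives convergence almost everywhere along subsequences, which passes through the continuous relative
flux (`IsFanCurve.distribDerivLE`). -/

noncomputable section

namespace ConsLaw

/-! ### Convex functions: tangent planes and Hessians. -/

section Convexity

variable {E : Type*} [NormedAddCommGroup E] [NormedSpace ℝ E]

/-- A convex function lies above its tangent planes. -/
theorem _root_.ConvexOn.add_fderiv_sub_le {s : Set E} {g : E → ℝ} {g' : E →L[ℝ] ℝ} {x y : E}
    (hg : ConvexOn ℝ s g) (hx : x ∈ s) (hy : y ∈ s) (hd : HasFDerivAt g g' x) :
    g x + g' (y - x) ≤ g y := by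
  have hl : HasDerivAt (fun t : ℝ => g (x + t • (y - x))) (g' (y - x)) 0 := by
    have h1 : HasDerivAt (fun t : ℝ => x + t • (y - x)) (y - x) 0 := by
      simpa using ((hasDerivAt_id (0 : ℝ)).smul_const (y - x)).const_add x
    have h2 : HasFDerivAt g g' (x + (0 : ℝ) • (y - x)) := by simpa using hd
    exact h2.comp_hasDerivAt 0 h1
  have ht := hl.tendsto_slope_zero_right
  have : g' (y - x) ≤ g y - g x := by
    refine le_of_tendsto ht ?_
    filter_upwards [Ioo_mem_nhdsGT (zero_lt_one' ℝ)] with t ht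
    have hc : g ((1 - t) • x + t • y) ≤ (1 - t) • g x + t • g y :=
      hg.2 hx hy (by linarith [ht.2]) ht.1.le (by ring)
    have he : (1 - t) • x + t • y = x + t • (y - x) := by
      rw [smul_sub, sub_smul, one_smul]; abel
    rw [he] at hc
    simp only [smul_eq_mul, zero_add, zero_smul, add_zero] at hc ⊢
    rw [inv_mul_le_iff₀ ht.1]
    linarith
  linarith

/-- A function that is convex in the interior of a convex set and continuous on the set lies above
its tangent planes at interior points. -/
theorem add_fderiv_sub_le_of_convexOn_interior {s : Set E} {g : E → ℝ} {g' : E →L[ℝ] ℝ} {x y : E}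
    (hs : Convex ℝ s) (hg : ConvexOn ℝ (interior s) g) (hc : ContinuousOn g s)
    (hx : x ∈ interior s) (hy : y ∈ s) (hd : HasFDerivAt g g' x) :
    g x + g' (y - x) ≤ g y := by
  -- A segment from an interior point stays in the interior until its far end, so the tangent
  -- inequality holds for `t < 1` and passes to `t = 1` by continuity on `s`.
  have hp : ∀ t ∈ Ico (0 : ℝ) 1, x + t • (y - x) ∈ interior s := fun t ht => by
    have := hs.add_smul_sub_mem_interior hy hx (t := 1 - t) ⟨by linarith [ht.2], by linarith [ht.1]⟩
    convert this using 1
    module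
  have hk : Continuous fun t : ℝ => x + t • (y - x) := by fun_prop
  have hmaps : ∀ᶠ t in 𝓝[<] (1 : ℝ), t ∈ Ico (0 : ℝ) 1 :=
    mem_of_superset (Ioo_mem_nhdsLT zero_lt_one) Ioo_subset_Ico_self
  have h1 : Tendsto (fun t : ℝ => x + t • (y - x)) (𝓝[<] 1) (𝓝[s] y) := by
    refine tendsto_nhdsWithin_iff.2 ⟨?_, hmaps.mono fun t ht => interior_subset (hp t ht)⟩
    have := (hk.tendsto 1).mono_left (nhdsWithin_le_nhds (s := Iio 1))
    simpa using this
  have h2 : Tendsto (fun t : ℝ => g x + g' (t • (y - x))) (𝓝[<] 1) (𝓝 (g x + g' (y - x))) := by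
    have hk' : Continuous fun t : ℝ => g x + g' (t • (y - x)) := by fun_prop
    have := (hk'.tendsto 1).mono_left (nhdsWithin_le_nhds (s := Iio 1))
    simpa using this
  refine le_of_tendsto_of_tendsto h2 ((hc y hy).tendsto.comp h1) (hmaps.mono fun t ht => ?_)
  simpa using hg.add_fderiv_sub_le hx (hp t ht) hd

/-- The Hessian of a convex function is positive semidefinite. -/
theorem fderiv_fderiv_nonneg_of_convexOn {s : Set E} {g : E → ℝ} {x : E}
    (hs : IsOpen s) (hg : ConvexOn ℝ s g) (hx : x ∈ s) (hd : ContDiffOn ℝ 2 g s) (r : E) :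
    0 ≤ fderiv ℝ (fderiv ℝ g) x r r := by
  have hat : ∀ y ∈ s, ContDiffAt ℝ 2 g y := fun y hy => hd.contDiffAt (hs.mem_nhds hy)
  have hdg : ∀ y ∈ s, HasFDerivAt g (fderiv ℝ g y) y := fun y hy =>
    ((hat y hy).differentiableAt two_ne_zero).hasFDerivAt
  have hdd : HasFDerivAt (fderiv ℝ g) (fderiv ℝ (fderiv ℝ g) x) x :=
    (((hat x hx).fderiv_right (m := 1) (by norm_num)).differentiableAt one_ne_zero).hasFDerivAt
  have hline : HasDerivAt (fun t : ℝ => x + t • r) r 0 := by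
    simpa using ((hasDerivAt_id (0 : ℝ)).smul_const r).const_add x
  have hl : HasDerivAt (fun t : ℝ => fderiv ℝ g (x + t • r) r) (fderiv ℝ (fderiv ℝ g) x r r) 0 := by
    have h2 : HasFDerivAt (fderiv ℝ g) (fderiv ℝ (fderiv ℝ g) x) (x + (0 : ℝ) • r) := by
      simpa using hdd
    exact (ContinuousLinearMap.apply ℝ ℝ r).hasFDerivAt.comp_hasDerivAt 0
      (h2.comp_hasDerivAt 0 hline)
  refine ge_of_tendsto hl.tendsto_slope_zero_right ?_
  have hmem : ∀ᶠ t in 𝓝[>] (0 : ℝ), x + t • r ∈ s := by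
    refine nhdsWithin_le_nhds (hline.continuousAt.eventually_mem (hs.mem_nhds ?_))
    simpa using hx
  filter_upwards [hmem, self_mem_nhdsWithin] with t ht ht0
  have ht0 : 0 < t := ht0
  -- Adding the tangent inequalities at the two end points gives monotonicity of the gradient along
  -- `r`, hence nonnegative difference quotients.
  have e1 := hg.add_fderiv_sub_le hx ht (hdg _ hx)
  have e2 := hg.add_fderiv_sub_le ht hx (hdg _ ht)
  have e3 : x + t • r - x = t • r := by abel
  have e4 : x - (x + t • r) = -(t • r) := by abel
  rw [e3] at e1
  rw [e4, map_neg] at e2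
  simp only [map_smul, smul_eq_mul] at e1 e2
  simp only [zero_add, zero_smul, add_zero, smul_eq_mul]
  have : 0 ≤ t * (fderiv ℝ g (x + t • r) r - fderiv ℝ g x r) := by linarith
  exact mul_nonneg (inv_nonneg.2 ht0.le) (nonneg_of_mul_nonneg_right this ht0)

/-- An isotropic vector of a positive semidefinite symmetric form belongs to its kernel. -/
theorem eq_zero_of_isotropic (D : E →L[ℝ] E →L[ℝ] ℝ) (hsym : ∀ v w, D v w = D w v)
    (hpos : ∀ v, 0 ≤ D v v) {r : E} (hr : D r r = 0) : D r = 0 := by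
  ext w
  -- Expanding `D (t r + w) (t r + w)` leaves an affine function of `t`, because the quadratic term
  -- vanishes. Being bounded below, it has zero slope; the witness below would give it the value
  -- `-1`.
  have key : ∀ t : ℝ, 0 ≤ 2 * t * D r w + D w w := fun t => by
    have := hpos (t • r + w)
    simp only [map_add, map_smul, add_apply, smul_apply,
      smul_eq_mul, hr, hsym w r] at this
    linarith
  by_contra hne
  have hne : D r w ≠ 0 := hne
  have := key (-(D w w + 1) / (2 * D r w))
  have h2 : 2 * (-(D w w + 1) / (2 * D r w)) * D r w = -(D w w + 1) := by field_simp
  linarith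

end Convexity

/-! ### Mollification, and measurability of compositions. -/

/-- Approximation of a `C¹` function with compact support by smooth ones: pointwise convergence of
the functions and of their derivatives, with uniform bounds and supports. -/
theorem exists_smooth_approx {h : ℝ → ℝ} (hh : ContDiff ℝ 1 h) (hc : HasCompactSupport h) :
    ∃ (k : ℕ → ℝ → ℝ) (R C : ℝ), (∀ n, ContDiff ℝ ∞ (k n)) ∧ (∀ n x, R < |x| → k n x = 0) ∧
      (∀ n x, R < |x| → deriv (k n) x = 0) ∧ (∀ n x, |k n x| ≤ C) ∧ (∀ n x, |deriv (k n) x| ≤ C) ∧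
      (∀ x, Tendsto (fun n => k n x) atTop (𝓝 (h x))) ∧
      (∀ x, Tendsto (fun n => deriv (k n) x) atTop (𝓝 (deriv h x))) := by
  have hh' : Continuous (deriv h) := hh.continuous_deriv le_rfl
  obtain ⟨C1, hC1⟩ := hc.exists_bound_of_continuous hh.continuous
  obtain ⟨C2, hC2⟩ := hc.deriv.exists_bound_of_continuous hh'
  obtain ⟨R, hR⟩ := hc.isBounded.subset_closedBall 0
  let φ : ℕ → ContDiffBump (0 : ℝ) := fun n =>
    ⟨1 / (n + 2), 1 / (n + 1), by positivity, by
      apply one_div_lt_one_div_of_lt <;> [positivity; linarith]⟩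
  have hφ : Tendsto (fun n => (φ n).rOut) atTop (𝓝 0) := tendsto_one_div_add_atTop_nhds_zero_nat
  let k : ℕ → ℝ → ℝ := fun n => convolution ((φ n).normed volume) h (ContinuousLinearMap.lsmul ℝ ℝ)
  have hk' : ∀ n x, HasDerivAt (k n)
      (convolution ((φ n).normed volume) (deriv h) (ContinuousLinearMap.lsmul ℝ ℝ) volume x) x :=
    fun n x => hc.hasDerivAt_convolution_right _
      ((φ n).contDiff_normed (n := 0) |>.continuous.locallyIntegrable) hh x
  have hdk : ∀ n x, deriv (k n) x =
      convolution ((φ n).normed volume) (deriv h) (ContinuousLinearMap.lsmul ℝ ℝ) volume x :=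
    fun n x => (hk' n x).deriv
  have hbd : ∀ (w : ℝ → ℝ) (C : ℝ), Continuous w → (∀ x, ‖w x‖ ≤ C) → ∀ n x,
      |convolution ((φ n).normed volume) w (ContinuousLinearMap.lsmul ℝ ℝ) volume x| ≤ 3 * C := by
    intro w C hw hC n x
    -- The mollified function is within the oscillation `2 * C` of `w`, which is itself at most `C`;
    -- this crude bound `3 * C` suffices for domination.
    have h1 := (φ n).dist_normed_convolution_le (μ := volume) (x₀ := x) (ε := 2 * C)
      hw.aestronglyMeasurable (fun y _ => by
        rw [dist_eq_norm]
        exact (norm_sub_le _ _).trans (by linarith [hC x, hC y]))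
    rw [dist_eq_norm, Real.norm_eq_abs] at h1
    have h2 := hC x
    rw [Real.norm_eq_abs] at h2
    have h3 := abs_sub_abs_le_abs_sub
      (convolution ((φ n).normed volume) w (ContinuousLinearMap.lsmul ℝ ℝ) volume x) (w x)
    linarith
  have hk0 : ∀ n x, R + 1 < |x| → k n x = 0 := by
    intro n x hx
    have hz : ∀ y ∈ Metric.ball x (φ n).rOut, h y = 0 := fun y hy => by
      by_contra hne
      have h1 := hR (subset_tsupport h hne)
      rw [mem_closedBall_zero_iff, Real.norm_eq_abs] at h1
      rw [Metric.mem_ball, Real.dist_eq] at hy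
      have h2 : (φ n).rOut ≤ 1 := by
        change (1 : ℝ) / (n + 1) ≤ 1
        rw [div_le_one (by positivity)]
        linarith [n.cast_nonneg (α := ℝ)]
      have h3 := abs_sub_abs_le_abs_sub x y
      rw [abs_sub_comm] at h3
      linarith
    have h0 := hz x (Metric.mem_ball_self (φ n).rOut_pos)
    have := (φ n).normed_convolution_eq_right (μ := volume) (g := h) (x₀ := x)
      (fun y hy => by rw [hz y hy, h0])
    exact this.trans h0
  refine ⟨k, R + 1, max (3 * C1) (3 * C2), fun n => ?_, hk0, fun n x hx => ?_, fun n x => ?_,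
    fun n x => ?_, fun x => ?_, fun x => ?_⟩
  · exact (φ n).hasCompactSupport_normed.contDiff_convolution_left _ (φ n).contDiff_normed
      hh.continuous.locallyIntegrable
  · have hev : k n =ᶠ[𝓝 x] fun _ => 0 := by
      filter_upwards [(isOpen_lt continuous_const continuous_abs).mem_nhds hx] with z hz
      exact hk0 n z hz
    rw [hev.deriv_eq, deriv_const]
  · exact (hbd h C1 hh.continuous hC1 n x).trans (le_max_left _ _)
  · rw [hdk]
    exact (hbd _ C2 hh' hC2 n x).trans (le_max_right _ _)
  · exact ContDiffBump.convolution_tendsto_right_of_continuous hφ hh.continuous x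
  · simp_rw [hdk]
    exact ContDiffBump.convolution_tendsto_right_of_continuous hφ hh' x

/-- A function that is continuous on a set, composed with a measurable function that takes almost
all its values in the set, is measurable; the set itself need not be. -/
theorem _root_.ContinuousOn.aestronglyMeasurable_comp {Ω X Y : Type*} [MeasurableSpace Ω]
    {μ : Measure Ω} [TopologicalSpace X] [TopologicalSpace.PseudoMetrizableSpace X]
    [TopologicalSpace Y] [TopologicalSpace.PseudoMetrizableSpace Y] [SecondCountableTopology Y]
    {s : Set X} {F : X → Y} {w : Ω → X} (hF : ContinuousOn F s)
    (hw : AEStronglyMeasurable w μ) (hs : ∀ᵐ p ∂μ, w p ∈ s) :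
    AEStronglyMeasurable (fun p => F (w p)) μ := by
  borelize X Y
  obtain ⟨w', hw', hww'⟩ := hw
  have hs' : ∀ᵐ p ∂μ, w' p ∈ s := by filter_upwards [hs, hww'] with p h1 h2 using h2 ▸ h1
  -- Off a measurable null set the map takes values in the subtype `s`, where continuity on `s`
  -- becomes plain continuity and no measurability of `s` is needed.
  obtain ⟨N, hN, hNm, hN0⟩ := exists_measurable_superset_of_null (ae_iff.1 hs')
  have hNs : ∀ p ∈ Nᶜ, w' p ∈ s := fun p hp => by
    by_contra hne
    exact hp (hN hne)
  have hae : ∀ᵐ p ∂μ, p ∈ Nᶜ := by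
    rw [ae_iff]; simpa using hN0
  let v : (Nᶜ : Set Ω) → s := fun p => ⟨w' p, hNs p p.2⟩
  have hv : Measurable v := (hw'.measurable.comp measurable_subtype_coe).subtype_mk
  have hm : Measurable fun p : (Nᶜ : Set Ω) => F (w' p) :=
    (continuousOn_iff_continuous_domRestrict.1 hF).measurable.comp hv
  have h1 : AEMeasurable (fun p => F (w' p)) (μ.restrict Nᶜ) :=
    (aemeasurable_restrict_iff_comap_subtype hNm.compl).2 hm.aemeasurable
  rw [Measure.restrict_eq_self_of_ae_mem hae] at h1
  refine h1.aestronglyMeasurable.congr ?_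
  filter_upwards [hww'] with p hp
  rw [hp]

/-! ### Self-similar test functions and the weak forms. -/

section SelfSimilar

theorem volume_restrict_halfPlane :
    (volume : Measure (ℝ × ℝ)).restrict halfPlane = (volume.restrict (Ioi 0)).prod volume := by
  rw [halfPlane, Measure.volume_eq_prod, ← Measure.prod_restrict, Measure.restrict_univ]

theorem measurableSet_halfPlane : MeasurableSet halfPlane := measurableSet_Ioi.prod .univ

theorem ae_halfPlane_pos : ∀ᵐ p : ℝ × ℝ ∂(volume.restrict halfPlane), 0 < p.1 :=
  (ae_restrict_mem measurableSet_halfPlane).mono fun _ hp => hp.1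

/-- A test function on `(0, ∞)` lives in a compact interval and is bounded with its derivative. -/
theorem exists_bounds_of_test {φ : ℝ → ℝ} (hφ : ContDiff ℝ ∞ φ) (hc : HasCompactSupport φ)
    (hs : tsupport φ ⊆ Ioi 0) :
    ∃ t0 t1 M : ℝ, 0 < t0 ∧ t0 < t1 ∧ 0 ≤ M ∧
      (∀ t, t ∉ Icc t0 t1 → φ t = 0 ∧ deriv φ t = 0) ∧ ∀ t, |φ t| ≤ M ∧ |deriv φ t| ≤ M := by
  obtain ⟨M1, hM1⟩ := hc.exists_bound_of_continuous hφ.continuous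
  obtain ⟨M2, hM2⟩ := hc.deriv.exists_bound_of_continuous (hφ.continuous_deriv (by simp))
  have hM1' := (norm_nonneg _).trans (hM1 0)
  obtain ⟨t0, t1, h0, h01, hsub⟩ : ∃ t0 t1 : ℝ, 0 < t0 ∧ t0 < t1 ∧ tsupport φ ⊆ Icc t0 t1 := by
    rcases (tsupport φ).eq_empty_or_nonempty with he | hne
    · exact ⟨1, 2, one_pos, one_lt_two, by simp [he]⟩
    · have hK : IsCompact (tsupport φ) := hc
      -- The added `1` makes the interval nondegenerate.
      refine ⟨sInf (tsupport φ), sSup (tsupport φ) + 1, hs (hK.sInf_mem hne), ?_, fun t ht => ?_⟩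
      · have := csInf_le hK.bddBelow (hK.sSup_mem hne)
        linarith
      · exact ⟨csInf_le hK.bddBelow ht, (le_csSup hK.bddAbove ht).trans (by linarith)⟩
  refine ⟨t0, t1, max M1 M2, h0, h01, hM1'.trans (le_max_left _ _), fun t ht => ?_, fun t => ?_⟩
  · have ht' : t ∉ tsupport φ := fun h => ht (hsub h)
    exact ⟨image_eq_zero_of_notMem_tsupport ht', by
      by_contra hne
      exact ht' (support_deriv_subset hne)⟩
  · exact ⟨(hM1 t).trans (le_max_left _ _), (hM2 t).trans (le_max_right _ _)⟩

/-- The compact part of the fan `|x / t| ≤ R`, `t0 ≤ t ≤ t1`. -/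
def fanBox (t0 t1 R : ℝ) : Set (ℝ × ℝ) := Icc t0 t1 ×ˢ Icc (-(R * t1)) (R * t1)

theorem isCompact_fanBox (t0 t1 R : ℝ) : IsCompact (fanBox t0 t1 R) := isCompact_Icc.prod isCompact_Icc

theorem mem_fanBox {t0 t1 R : ℝ} (h0 : 0 < t0) {p : ℝ × ℝ} (ht : p.1 ∈ Icc t0 t1)
    (hR : |p.2 / p.1| ≤ R) : p ∈ fanBox t0 t1 R := by
  have hp : 0 < p.1 := h0.trans_le ht.1
  rw [abs_div, abs_of_pos hp, div_le_iff₀ hp] at hR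
  have hR0 : 0 ≤ R := nonneg_of_mul_nonneg_left ((abs_nonneg _).trans hR) hp
  exact ⟨ht, abs_le.1 (hR.trans (mul_le_mul_of_nonneg_left ht.2 hR0))⟩

theorem integrable_fanBox_indicator (t0 t1 R C : ℝ) :
    Integrable ((fanBox t0 t1 R).indicator fun _ => C) (volume.restrict halfPlane) :=
  ((integrable_indicator_iff (isCompact_fanBox _ _ _).measurableSet).2
    (integrableOn_const (isCompact_fanBox _ _ _).measure_lt_top.ne)).mono_measure
      Measure.restrict_le_self

/-- A bounded measurable function that vanishes outside of a fan box is integrable. -/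
theorem integrable_of_fanBox {F : ℝ × ℝ → ℝ} {t0 t1 R C : ℝ}
    (hF : AEStronglyMeasurable F (volume.restrict halfPlane))
    (hC : ∀ᵐ p ∂(volume.restrict halfPlane), |F p| ≤ (fanBox t0 t1 R).indicator (fun _ => C) p) :
    Integrable F (volume.restrict halfPlane) :=
  (integrable_fanBox_indicator t0 t1 R C).mono' hF hC

/-- The function `(t, x) ↦ φ(t) h(x/t)`. -/
def fanTest (φ h : ℝ → ℝ) (p : ℝ × ℝ) : ℝ := φ p.1 * h (p.2 / p.1)

/-- The quotient `x/t` is singular only at `t = 0`, and off the closed support of `φ` the product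
vanishes in a neighbourhood. -/
theorem contDiff_fanTest {φ h : ℝ → ℝ} (hφ : ContDiff ℝ ∞ φ) (hs : tsupport φ ⊆ Ioi 0)
    (hh : ContDiff ℝ ∞ h) : ContDiff ℝ ∞ (fanTest φ h) := by
  rw [contDiff_iff_contDiffAt]
  intro p
  by_cases hp : p.1 ∈ tsupport φ
  · have hp0 : p.1 ≠ 0 := (hs hp).ne'
    exact (hφ.comp contDiff_fst).contDiffAt.mul
      (hh.contDiffAt.comp p (contDiffAt_snd.div contDiffAt_fst hp0))
  · have : fanTest φ h =ᶠ[𝓝 p] fun _ => 0 := by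
      have h1 : ∀ᶠ t in 𝓝 p.1, φ t = 0 := notMem_tsupport_iff_eventuallyEq.1 hp
      filter_upwards [continuous_fst.continuousAt.eventually h1] with z hz
      simp [fanTest, hz]
    exact contDiffAt_const.congr_of_eventuallyEq this

/-- In the coordinates `(t, y)` the support lies in a compact product, which `(t, y) ↦ (t, t y)`
maps to a compact set. -/
theorem hasCompactSupport_fanTest {φ h : ℝ → ℝ} (hc : HasCompactSupport φ)
    (hs : tsupport φ ⊆ Ioi 0) (hhc : HasCompactSupport h) : HasCompactSupport (fanTest φ h) := by
  have hK : IsCompact ((fun p : ℝ × ℝ => (p.1, p.1 * p.2)) '' (tsupport φ ×ˢ tsupport h)) :=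
    (hc.isCompact.prod hhc.isCompact).image (by fun_prop)
  refine HasCompactSupport.of_support_subset_isCompact hK fun p hp => ?_
  have hp' : φ p.1 * h (p.2 / p.1) ≠ 0 := hp
  have h1 : p.1 ∈ tsupport φ := subset_tsupport _ (left_ne_zero_of_mul hp')
  refine ⟨(p.1, p.2 / p.1), ⟨h1, subset_tsupport _ (right_ne_zero_of_mul hp')⟩, ?_⟩
  have hp0 : p.1 ≠ 0 := (hs h1).ne'
  ext
  · rfl
  · change p.1 * (p.2 / p.1) = p.2
    field_simp

theorem fderiv_fanTest {φ h : ℝ → ℝ} (hφ : Differentiable ℝ φ) (hh : Differentiable ℝ h)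
    {p : ℝ × ℝ} (hp : 0 < p.1) :
    fderiv ℝ (fanTest φ h) p (1, 0) = deriv φ p.1 * h (p.2 / p.1)
      - φ p.1 / p.1 * deriv h (p.2 / p.1) * (p.2 / p.1) ∧
    fderiv ℝ (fanTest φ h) p (0, 1) = φ p.1 / p.1 * deriv h (p.2 / p.1) := by
  have hd : HasFDerivAt (fun p : ℝ × ℝ => p.2 / p.1)
      ((p.1)⁻¹ • ContinuousLinearMap.snd ℝ ℝ ℝ
        - (p.2 / p.1 ^ 2) • ContinuousLinearMap.fst ℝ ℝ ℝ) p := by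
    have h1 : HasFDerivAt (fun p : ℝ × ℝ => p.1) (ContinuousLinearMap.fst ℝ ℝ ℝ) p := hasFDerivAt_fst
    have h2 : HasFDerivAt (fun p : ℝ × ℝ => p.2) (ContinuousLinearMap.snd ℝ ℝ ℝ) p := hasFDerivAt_snd
    have h3 := h2.mul ((hasDerivAt_inv hp.ne').comp_hasFDerivAt p h1)
    simp only [div_eq_mul_inv]
    refine HasFDerivAt.congr_fderiv h3 ?_
    ext <;> simp
  have h1 : HasFDerivAt (fun p : ℝ × ℝ => φ p.1) (deriv φ p.1 • ContinuousLinearMap.fst ℝ ℝ ℝ) p :=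
    (hφ p.1).hasDerivAt.comp_hasFDerivAt p hasFDerivAt_fst
  have h2 := (hh (p.2 / p.1)).hasDerivAt.comp_hasFDerivAt p hd
  have h3 : HasFDerivAt (fanTest φ h) _ p := h1.mul h2
  rw [h3.fderiv]
  constructor <;> simp <;> field_simp
  ring

/-- The integrand of the weak form of `a_t + c_x = 0` for the test function `φ(t) h(x/t)`. -/
def fanIntegrand (φ h : ℝ → ℝ) (a c : ℝ × ℝ → ℝ) (p : ℝ × ℝ) : ℝ :=
  deriv φ p.1 * h (p.2 / p.1) * a p
    + φ p.1 / p.1 * deriv h (p.2 / p.1) * (c p - p.2 / p.1 * a p)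

theorem measurable_ratio : Measurable fun p : ℝ × ℝ => p.2 / p.1 := measurable_snd.div measurable_fst

theorem aestronglyMeasurable_fanIntegrand {φ h : ℝ → ℝ} {a c : ℝ × ℝ → ℝ} (hφ : ContDiff ℝ ∞ φ)
    (hh : ContDiff ℝ 1 h) (ha : AEStronglyMeasurable a (volume.restrict halfPlane))
    (hc : AEStronglyMeasurable c (volume.restrict halfPlane)) :
    AEStronglyMeasurable (fanIntegrand φ h a c) (volume.restrict halfPlane) := by
  have m1 : Measurable fun p : ℝ × ℝ => deriv φ p.1 * h (p.2 / p.1) :=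
    ((measurable_deriv φ).comp measurable_fst).mul (hh.continuous.measurable.comp measurable_ratio)
  have m2 : Measurable fun p : ℝ × ℝ => φ p.1 / p.1 * deriv h (p.2 / p.1) :=
    ((hφ.continuous.measurable.comp measurable_fst).div measurable_fst).mul
      ((measurable_deriv h).comp measurable_ratio)
  exact (m1.aestronglyMeasurable.mul ha).add
    (m2.aestronglyMeasurable.mul (hc.sub (measurable_ratio.aestronglyMeasurable.mul ha)))

/-- The bound depends on `h` only through `R` and `C`, so it dominates a whole sequence of mollified
profiles as well as giving integrability. -/
theorem abs_fanIntegrand_le {φ h : ℝ → ℝ} {a c : ℝ × ℝ → ℝ} {t0 t1 M R C K : ℝ} {p : ℝ × ℝ}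
    (h0 : 0 < t0) (hz : ∀ t, t ∉ Icc t0 t1 → φ t = 0 ∧ deriv φ t = 0)
    (hM : ∀ t, |φ t| ≤ M ∧ |deriv φ t| ≤ M) (hR : ∀ y, R < |y| → h y = 0 ∧ deriv h y = 0)
    (hC : ∀ y, |h y| ≤ C ∧ |deriv h y| ≤ C) (ha : |a p| ≤ K) (hc : |c p| ≤ K) :
    |fanIntegrand φ h a c p| ≤
      (fanBox t0 t1 R).indicator (fun _ => M * C * K + M / t0 * C * (K + R * K)) p := by
  by_cases ht : p.1 ∈ Icc t0 t1
  · by_cases hy : |p.2 / p.1| ≤ R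
    · rw [indicator_of_mem (mem_fanBox h0 ht hy)]
      have hM0 : 0 ≤ M := (abs_nonneg _).trans (hM 0).1
      have hC0 : 0 ≤ C := (abs_nonneg _).trans (hC 0).1
      have hK0 : 0 ≤ K := (abs_nonneg _).trans ha
      have hR0 : 0 ≤ R := (abs_nonneg _).trans hy
      have hdiv : |φ p.1 / p.1| ≤ M / t0 := by
        rw [abs_div, abs_of_pos (h0.trans_le ht.1)]
        exact div_le_div₀ hM0 (hM _).1 h0 ht.1
      have h3 : |c p - p.2 / p.1 * a p| ≤ K + R * K := by
        refine (abs_sub _ _).trans (add_le_add hc ?_)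
        rw [abs_mul]
        exact mul_le_mul hy ha (abs_nonneg _) hR0
      refine (abs_add_le _ _).trans (add_le_add ?_ ?_)
      · rw [abs_mul, abs_mul]
        exact mul_le_mul (mul_le_mul (hM _).2 (hC _).1 (abs_nonneg _) hM0) ha (abs_nonneg _)
          (by positivity)
      · rw [abs_mul, abs_mul]
        exact mul_le_mul (mul_le_mul hdiv (hC _).2 (abs_nonneg _) (by positivity)) h3
          (abs_nonneg _) (by positivity)
    · have hy0 := hR _ (not_le.1 hy)
      have hz' : fanIntegrand φ h a c p = 0 := by simp [fanIntegrand, hy0.1, hy0.2]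
      rw [hz', abs_zero]
      refine indicator_apply_nonneg fun hmem => ?_
      have hM0 : 0 ≤ M := (abs_nonneg _).trans (hM 0).1
      have hC0 : 0 ≤ C := (abs_nonneg _).trans (hC 0).1
      have hK0 : 0 ≤ K := (abs_nonneg _).trans ha
      -- The sign of `R` is not assumed; it follows from the fan box being nonempty.
      have hR0 : 0 ≤ R := by
        have h1 := hmem.2.1.trans hmem.2.2
        have h2 : 0 < t1 := h0.trans_le (ht.1.trans ht.2)
        by_contra hlt
        nlinarith
      positivity
  · have hz' : fanIntegrand φ h a c p = 0 := by simp [fanIntegrand, (hz _ ht).1, (hz _ ht).2]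
    rw [hz', abs_zero, indicator_of_notMem]
    exact fun hmem => ht hmem.1

theorem exists_bounds_of_contDiff_one {h : ℝ → ℝ} (hh : ContDiff ℝ 1 h) (hc : HasCompactSupport h) :
    ∃ R C : ℝ, (∀ y, R < |y| → h y = 0 ∧ deriv h y = 0) ∧ ∀ y, |h y| ≤ C ∧ |deriv h y| ≤ C := by
  obtain ⟨C1, hC1⟩ := hc.exists_bound_of_continuous hh.continuous
  obtain ⟨C2, hC2⟩ := hc.deriv.exists_bound_of_continuous (hh.continuous_deriv le_rfl)
  obtain ⟨R, hR⟩ := hc.isBounded.subset_closedBall 0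
  refine ⟨R, max C1 C2, fun y hy => ?_, fun y =>
    ⟨(hC1 y).trans (le_max_left _ _), (hC2 y).trans (le_max_right _ _)⟩⟩
  have hy' : y ∉ tsupport h := fun hmem => by
    have := hR hmem
    rw [mem_closedBall_zero_iff, Real.norm_eq_abs] at this
    linarith
  exact ⟨image_eq_zero_of_notMem_tsupport hy', by
    by_contra hne
    exact hy' (support_deriv_subset hne)⟩

theorem integrable_fanIntegrand {φ h : ℝ → ℝ} {a c : ℝ × ℝ → ℝ} {K : ℝ}
    (hφ : ContDiff ℝ ∞ φ) (hφc : HasCompactSupport φ) (hs : tsupport φ ⊆ Ioi 0)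
    (hh : ContDiff ℝ 1 h) (hhc : HasCompactSupport h)
    (ha : AEStronglyMeasurable a (volume.restrict halfPlane))
    (hc : AEStronglyMeasurable c (volume.restrict halfPlane))
    (haK : ∀ᵐ p ∂(volume.restrict halfPlane), |a p| ≤ K)
    (hcK : ∀ᵐ p ∂(volume.restrict halfPlane), |c p| ≤ K) :
    Integrable (fanIntegrand φ h a c) (volume.restrict halfPlane) := by
  obtain ⟨t0, t1, M, h0, -, -, hz, hM⟩ := exists_bounds_of_test hφ hφc hs
  obtain ⟨R, C, hR, hC⟩ := exists_bounds_of_contDiff_one hh hhc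
  refine integrable_of_fanBox (aestronglyMeasurable_fanIntegrand hφ hh ha hc)
    (t0 := t0) (t1 := t1) (R := R) (C := M * C * K + M / t0 * C * (K + R * K)) ?_
  filter_upwards [haK, hcK] with p h1 h2
  exact abs_fanIntegrand_le h0 hz hM hR hC h1 h2

/-- A weak equation tested by `φ(t) h(x/t)` for smooth `h` may be tested by `C¹` functions `h`. -/
theorem integral_fanIntegrand_eq_zero_of_contDiff_one {φ : ℝ → ℝ} {a c : ℝ × ℝ → ℝ} {K : ℝ}
    (hφ : ContDiff ℝ ∞ φ) (hφc : HasCompactSupport φ) (hs : tsupport φ ⊆ Ioi 0)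
    (ha : AEStronglyMeasurable a (volume.restrict halfPlane))
    (hc : AEStronglyMeasurable c (volume.restrict halfPlane))
    (haK : ∀ᵐ p ∂(volume.restrict halfPlane), |a p| ≤ K)
    (hcK : ∀ᵐ p ∂(volume.restrict halfPlane), |c p| ≤ K)
    (H : ∀ h : ℝ → ℝ, ContDiff ℝ ∞ h → HasCompactSupport h →
      ∫ p in halfPlane, fanIntegrand φ h a c p = 0)
    {h : ℝ → ℝ} (hh : ContDiff ℝ 1 h) (hhc : HasCompactSupport h) :
    ∫ p in halfPlane, fanIntegrand φ h a c p = 0 := by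
  obtain ⟨t0, t1, M, h0, -, -, hz, hM⟩ := exists_bounds_of_test hφ hφc hs
  obtain ⟨k, R, C, hk, hk0, hk0', hkC, hkC', hkt, hkt'⟩ := exists_smooth_approx hh hhc
  -- The mollified profiles share one support radius and one `C¹` bound, so a single fan box
  -- indicator dominates all the integrands.
  have hlim := tendsto_integral_of_dominated_convergence (μ := volume.restrict halfPlane)
    (F := fun n => fanIntegrand φ (k n) a c) (f := fanIntegrand φ h a c) _
    (fun n => aestronglyMeasurable_fanIntegrand hφ ((hk n).of_le (by simp)) ha hc)
    (integrable_fanBox_indicator t0 t1 R (M * C * K + M / t0 * C * (K + R * K)))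
    (fun n => by
      filter_upwards [haK, hcK] with p h1 h2
      exact abs_fanIntegrand_le h0 hz hM (fun y hy => ⟨hk0 n y hy, hk0' n y hy⟩)
        (fun y => ⟨hkC n y, hkC' n y⟩) h1 h2)
    (Eventually.of_forall fun p =>
      (((hkt _).const_mul _).mul_const _).add (((hkt' _).const_mul _).mul_const _))
  have hcs : ∀ n, HasCompactSupport (k n) := fun n =>
    HasCompactSupport.of_support_subset_isCompact (isCompact_Icc (a := -R) (b := R)) fun x hx => by
      by_contra hne
      exact hx (hk0 n x (by
        by_contra hle
        exact hne (abs_le.1 (not_lt.1 hle))))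
  have h0' : (fun n => ∫ p in halfPlane, fanIntegrand φ (k n) a c p) = fun _ => 0 :=
    funext fun n => H (k n) (hk n) (hcs n)
  rw [h0'] at hlim
  exact (tendsto_nhds_unique hlim tendsto_const_nhds)

/-- This removes the initial data from both weak formulations. -/
theorem fanTest_zero {φ h : ℝ → ℝ} (hs : tsupport φ ⊆ Ioi 0) (x : ℝ) : fanTest φ h (0, x) = 0 := by
  have : φ 0 = 0 := image_eq_zero_of_notMem_tsupport fun h => lt_irrefl (0 : ℝ) (hs h)
  simp [fanTest, this]

/-- The entropy inequality tested by `φ(t) g(x/t)`. -/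
theorem IsEntropic.integral_fanIntegrand_nonneg {η q : State → ℝ} {u : ℝ → ℝ → State}
    {u0 : ℝ → State} (H : IsEntropic η q u u0) {φ g : ℝ → ℝ}
    (hφ : ContDiff ℝ ∞ φ) (hφc : HasCompactSupport φ) (hs : tsupport φ ⊆ Ioi 0) (hφ0 : ∀ t, 0 ≤ φ t)
    (hg : ContDiff ℝ ∞ g) (hgc : HasCompactSupport g) (hg0 : ∀ y, 0 ≤ g y) :
    0 ≤ ∫ p in halfPlane, fanIntegrand φ g (fun p => η (u p.1 p.2)) (fun p => q (u p.1 p.2)) p := by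
  have h := H (fanTest φ g) (contDiff_fanTest hφ hs hg) (hasCompactSupport_fanTest hφc hs hgc)
    (fun p => mul_nonneg (hφ0 _) (hg0 _))
  simp only [fanTest_zero hs, zero_mul, integral_zero, add_zero] at h
  refine h.trans_eq (setIntegral_congr_fun measurableSet_halfPlane fun p hp => ?_)
  obtain ⟨h1, h2⟩ := fderiv_fanTest (hφ.differentiable (by simp)) (hg.differentiable (by simp)) hp.1
  simp only [h1, h2, fanIntegrand]
  ring

/-- The components of the weak equation tested by `φ(t) h(x/t)`, for `h` of class `C¹`. -/
theorem IsWeakSolution.integral_fanIntegrand_eq_zero {f : State → State} {u : ℝ → ℝ → State}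
    {u0 : ℝ → State} (H : IsWeakSolution f u u0) {K : ℝ}
    (hu : AEStronglyMeasurable (fun p : ℝ × ℝ => u p.1 p.2) (volume.restrict halfPlane))
    (hfu : AEStronglyMeasurable (fun p : ℝ × ℝ => f (u p.1 p.2)) (volume.restrict halfPlane))
    (huK : ∀ᵐ p : ℝ × ℝ ∂(volume.restrict halfPlane), ‖u p.1 p.2‖ ≤ K)
    (hfuK : ∀ᵐ p : ℝ × ℝ ∂(volume.restrict halfPlane), ‖f (u p.1 p.2)‖ ≤ K) {φ h : ℝ → ℝ}
    (hφ : ContDiff ℝ ∞ φ) (hφc : HasCompactSupport φ) (hs : tsupport φ ⊆ Ioi 0)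
    (hh : ContDiff ℝ 1 h) (hhc : HasCompactSupport h) (k : Fin 2) :
    ∫ p in halfPlane, fanIntegrand φ h (fun p => u p.1 p.2 k) (fun p => f (u p.1 p.2) k) p = 0 := by
  have hcomp : ∀ {w : ℝ × ℝ → State}, AEStronglyMeasurable w (volume.restrict halfPlane) →
      ∀ k, AEStronglyMeasurable (fun p => w p k) (volume.restrict halfPlane) := fun hw k =>
    (EuclideanSpace.proj k : State →L[ℝ] ℝ).continuous.comp_aestronglyMeasurable hw
  have hle : ∀ {w : ℝ × ℝ → State}, (∀ᵐ p ∂(volume.restrict halfPlane), ‖w p‖ ≤ K) →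
      ∀ k, ∀ᵐ p ∂(volume.restrict halfPlane), |w p k| ≤ K := fun {w} hw k =>
    hw.mono fun p hp => (PiLp.norm_apply_le (w p) k).trans hp
  refine integral_fanIntegrand_eq_zero_of_contDiff_one hφ hφc hs (hcomp hu k) (hcomp hfu k)
    (hle huK k) (hle hfuK k) (fun g hg hgc => ?_) hh hhc
  have hw := H (fanTest φ g) (contDiff_fanTest hφ hs hg) (hasCompactSupport_fanTest hφc hs hgc)
  simp only [fanTest_zero hs, zero_smul, integral_zero, add_zero] at hw
  have hcongr : ∫ p in halfPlane, (fderiv ℝ (fanTest φ g) p (1, 0) • u p.1 p.2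
      + fderiv ℝ (fanTest φ g) p (0, 1) • f (u p.1 p.2)) =
      ∫ p in halfPlane, ((deriv φ p.1 * g (p.2 / p.1)
        - φ p.1 / p.1 * deriv g (p.2 / p.1) * (p.2 / p.1)) • u p.1 p.2
        + (φ p.1 / p.1 * deriv g (p.2 / p.1)) • f (u p.1 p.2)) :=
    setIntegral_congr_fun measurableSet_halfPlane fun p hp => by
      obtain ⟨h1, h2⟩ :=
        fderiv_fanTest (hφ.differentiable (by simp)) (hg.differentiable (by simp)) hp.1
      simp only [h1, h2]
  rw [hcongr] at hw
  have hproj : ∀ (k : Fin 2) (p : ℝ × ℝ), fanIntegrand φ g (fun p => u p.1 p.2 k) (fun p => f (u p.1 p.2) k) p =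
      ((deriv φ p.1 * g (p.2 / p.1)
        - φ p.1 / p.1 * deriv g (p.2 / p.1) * (p.2 / p.1)) • u p.1 p.2
        + (φ p.1 / p.1 * deriv g (p.2 / p.1)) • f (u p.1 p.2)) k := fun k p => by
    simp [fanIntegrand]
    ring
  -- Taking components commutes with the vector-valued integral only once that integral is known to
  -- converge.
  have hint : Integrable (fun p : ℝ × ℝ => (deriv φ p.1 * g (p.2 / p.1)
        - φ p.1 / p.1 * deriv g (p.2 / p.1) * (p.2 / p.1)) • u p.1 p.2
        + (φ p.1 / p.1 * deriv g (p.2 / p.1)) • f (u p.1 p.2)) (volume.restrict halfPlane) := by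
    refine Integrable.of_eval_piLp fun k => ?_
    simp_rw [← hproj]
    exact integrable_fanIntegrand hφ hφc hs (hg.of_le (by simp)) hgc (hcomp hu k) (hcomp hfu k)
      (hle huK k) (hle hfuK k)
  simp_rw [hproj]
  have := (EuclideanSpace.proj k : State →L[ℝ] ℝ).integral_comp_comm hint
  rw [hw] at this
  simpa using this

end SelfSimilar

/-! ### The rarefaction curve and the sign of the source term. -/

section FanCurve

/-- A continuous curve of interior states with compact range that is an integral curve of `f'`,
parametrized by the characteristic speed, for parameters in `(vL, vR)`. -/
structure IsFanCurve (V0 : Set State) (f : State → State) (vL vR : ℝ) (b b' : ℝ → State) : Prop where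
  continuous : Continuous b
  isCompact_range : IsCompact (range b)
  mem : ∀ y, b y ∈ interior V0
  hasDerivAt : ∀ y ∈ Ioo vL vR, HasDerivAt b (b' y) y
  continuousOn_deriv : ContinuousOn b' (Ioo vL vR)
  speed : ∀ y ∈ Ioo vL vR, fderiv ℝ f (b y) (b' y) = y • b' y

/-- The profile is extended by constants, so that compositions with `x/t` make sense everywhere and
stay in a compact set of interior states. Differential identities are kept only on the open
interval, where `derivWithin` is the ordinary derivative. -/
theorem IsRarefaction.isFanCurve {V0 : Set State} {f : State → State} {lam : Fin 2 → State → ℝ}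
    {i : Fin 2} {vL vR : ℝ} {ubar : ℝ → State} (h : IsRarefaction V0 f lam i vL vR ubar) :
    IsFanCurve V0 f vL vR (IccExtend h.lt.le ((Icc vL vR).domRestrict ubar)) (deriv ubar) := by
  have hdw : ∀ y ∈ Ioo vL vR, derivWithin ubar (Icc vL vR) y = deriv ubar y := fun y hy =>
    derivWithin_of_mem_nhds (Icc_mem_nhds hy.1 hy.2)
  have hev : ∀ y ∈ Ioo vL vR, IccExtend h.lt.le ((Icc vL vR).domRestrict ubar) =ᶠ[𝓝 y] ubar :=
    fun y hy => by
      filter_upwards [Icc_mem_nhds hy.1 hy.2] with z hz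
      exact IccExtend_of_mem _ _ hz
  have hsm : ContDiffOn ℝ 1 ubar (Ioo vL vR) := h.smooth.mono Ioo_subset_Icc_self
  have hmem : ∀ y, IccExtend h.lt.le ((Icc vL vR).domRestrict ubar) y ∈ interior V0 := fun y =>
    h.mem _ (projIcc vL vR h.lt.le y).2
  refine ⟨h.smooth.continuousOn.domRestrict.Icc_extend', ?_, hmem, fun y hy => ?_, ?_, fun y hy => ?_⟩
  · rw [IccExtend_range]
    exact isCompact_range h.smooth.continuousOn.domRestrict
  · refine HasDerivAt.congr_of_eventuallyEq ?_ (hev y hy)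
    exact ((hsm.differentiableOn one_ne_zero).differentiableAt
      (Ioo_mem_nhds hy.1 hy.2)).hasDerivAt
  · exact hsm.continuousOn_deriv_of_isOpen isOpen_Ioo le_rfl
  · have he := (h.eigenvector y (Ioo_subset_Icc_self hy)).apply_eq_smul
    rw [hdw y hy, h.speed y (Ioo_subset_Icc_self hy)] at he
    rw [(hev y hy).self_of_nhds]
    exact he

variable {V0 : Set State} {f : State → State} {η q : State → ℝ} {lam : Fin 2 → State → ℝ}

theorem System.contDiffAt_flux (hsys : System V0 f η q lam) {a : State} (ha : a ∈ interior V0) :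
    ContDiffAt ℝ 4 f a := hsys.flux_smooth.contDiffAt (isOpen_interior.mem_nhds ha)

theorem System.contDiffAt_entropy (hsys : System V0 f η q lam) {a : State} (ha : a ∈ interior V0) :
    ContDiffAt ℝ 3 η a := hsys.entropy_smooth.contDiffAt (isOpen_interior.mem_nhds ha)

theorem System.contDiffAt_entropyFlux (hsys : System V0 f η q lam) {a : State}
    (ha : a ∈ interior V0) : ContDiffAt ℝ 3 q a :=
  hsys.entropyFlux_smooth.contDiffAt (isOpen_interior.mem_nhds ha)

theorem System.hasFDerivAt_flux (hsys : System V0 f η q lam) {a : State} (ha : a ∈ interior V0) :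
    HasFDerivAt f (fderiv ℝ f a) a :=
  ((hsys.contDiffAt_flux ha).differentiableAt (by norm_num)).hasFDerivAt

theorem System.hasFDerivAt_entropy (hsys : System V0 f η q lam) {a : State}
    (ha : a ∈ interior V0) : HasFDerivAt η (fderiv ℝ η a) a :=
  ((hsys.contDiffAt_entropy ha).differentiableAt (by norm_num)).hasFDerivAt

theorem System.hasFDerivAt_entropyFlux (hsys : System V0 f η q lam) {a : State}
    (ha : a ∈ interior V0) : HasFDerivAt q (fderiv ℝ q a) a :=
  ((hsys.contDiffAt_entropyFlux ha).differentiableAt (by norm_num)).hasFDerivAt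

theorem System.hasFDerivAt_fderiv_entropy (hsys : System V0 f η q lam) {a : State}
    (ha : a ∈ interior V0) : HasFDerivAt (fderiv ℝ η) (fderiv ℝ (fderiv ℝ η) a) a :=
  (((hsys.contDiffAt_entropy ha).fderiv_right (m := 1) (by norm_num)).differentiableAt
    one_ne_zero).hasFDerivAt

theorem System.entropy_hessian_symm (hsys : System V0 f η q lam) {a : State}
    (ha : a ∈ interior V0) (v w : State) :
    fderiv ℝ (fderiv ℝ η) a v w = fderiv ℝ (fderiv ℝ η) a w v :=
  (hsys.contDiffAt_entropy ha).isSymmSndFDerivAt (by simp; norm_num) v w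

/-- The Hessian of the entropy symmetrizes the Jacobian of the flux. -/
theorem System.hessian_symmetrizes (hsys : System V0 f η q lam) {a : State}
    (ha : a ∈ interior V0) (v w : State) :
    fderiv ℝ (fderiv ℝ η) a v (fderiv ℝ f a w) = fderiv ℝ (fderiv ℝ η) a w (fderiv ℝ f a v) := by
  have hf2 : HasFDerivAt (fderiv ℝ f) (fderiv ℝ (fderiv ℝ f) a) a :=
    (((hsys.contDiffAt_flux ha).fderiv_right (m := 1) (by norm_num)).differentiableAt
      one_ne_zero).hasFDerivAt
  have hev : fderiv ℝ q =ᶠ[𝓝 a] fun z => (fderiv ℝ η z).comp (fderiv ℝ f z) := by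
    filter_upwards [isOpen_interior.mem_nhds ha] with z hz using hsys.compatible z hz
  have hq2 := ((hsys.hasFDerivAt_fderiv_entropy ha).clm_comp hf2).congr_of_eventuallyEq hev
  -- Differentiating the compatibility relation gives `q'' = η' f'' + η'' f'`. Since `q''` and `f''`
  -- are symmetric, so is the remaining term.
  have key : ∀ v w, fderiv ℝ (fderiv ℝ q) a v w =
      fderiv ℝ η a (fderiv ℝ (fderiv ℝ f) a v w) + fderiv ℝ (fderiv ℝ η) a v (fderiv ℝ f a w) :=
    fun v w => by rw [hq2.fderiv]; simp
  have hqs := (hsys.contDiffAt_entropyFlux ha).isSymmSndFDerivAt (by simp; norm_num) v w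
  have hfs := (hsys.contDiffAt_flux ha).isSymmSndFDerivAt (by simp; norm_num) v w
  rw [key, key, hfs] at hqs
  exact add_left_cancel hqs

theorem System.convexOn_entropy (hsys : System V0 f η q lam) : ConvexOn ℝ (interior V0) η :=
  hsys.strictConvex.convexOn.subset interior_subset hsys.strictConvex.1.interior

variable {vL vR : ℝ} {b b' : ℝ → State}

/-- Along a rarefaction, the source term of the relative entropy has a sign. -/
theorem IsFanCurve.source_nonneg (hb : IsFanCurve V0 f vL vR b b') (hsys : System V0 f η q lam)
    {y : ℝ} (hy : y ∈ Ioo vL vR) {a : State} (ha : a ∈ V0) :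
    0 ≤ fderiv ℝ (fderiv ℝ η) (b y) (b' y) (f a - f (b y) - y • (a - b y)) := by
  set D := fderiv ℝ (fderiv ℝ η) (b y) with hD
  set ℓ := D (b' y) with hℓ
  have hm := hb.mem y
  have hpos : ∀ v, 0 ≤ D v v := fun v =>
    fderiv_fderiv_nonneg_of_convexOn isOpen_interior hsys.convexOn_entropy hm
      (hsys.entropy_smooth.of_le (by norm_num)) v
  -- Symmetrization moves `f'(b)` onto `b'`, where it acts as multiplication by `y`.
  have hleft : ∀ w, ℓ (fderiv ℝ f (b y) w) = y * ℓ w := fun w => by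
    rw [hℓ, hD, hsys.hessian_symmetrizes hm, hb.speed y hy, map_smul, smul_eq_mul,
      hsys.entropy_hessian_symm hm]
  -- Strict convexity of the entropy allows a degenerate Hessian. If `b'` is isotropic it lies in
  -- the kernel, so `ℓ = 0` and the source vanishes.
  rcases (hpos (b' y)).eq_or_lt with h0 | hlt
  · rw [hℓ, eq_zero_of_isotropic D (hsys.entropy_hessian_symm hm) hpos h0.symm]
    simp
  have hne : ℓ ≠ 0 := fun h => by
    rw [← hℓ, h] at hlt
    exact lt_irrefl (0 : ℝ) hlt
  have hdf : ∀ z, HasFDerivAt (fun u => ℓ (f u)) (ℓ.comp (fderiv ℝ f (b z))) (b z) := fun z =>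
    ℓ.hasFDerivAt.comp (b z) (hsys.hasFDerivAt_flux (hb.mem z))
  have hcont : ContinuousOn (fun u => ℓ (f u)) V0 := ℓ.continuous.comp_continuousOn hsys.flux_continuous
  have hℓa : ∀ a, ℓ (f a - f (b y) - y • (a - b y)) = ℓ (f a) - ℓ (f (b y)) - y * ℓ (a - b y) :=
    fun a => by simp only [map_sub, map_smul, smul_eq_mul]
  -- As `ℓ f'(b) = y ℓ`, the source is the gap between `ℓ · f` and its tangent plane at `b y`:
  -- nonnegative if convex, while the concave case is contradictory.
  rcases hsys.leftEigenvector (b y) hm ℓ y hne (by ext w; simp [hleft]) with hconv | hconc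
  · have := add_fderiv_sub_le_of_convexOn_interior hsys.strictConvex.1 hconv hcont hm ha (hdf y)
    rw [ContinuousLinearMap.comp_apply, hleft] at this
    rw [hℓa]
    linarith
  · exfalso
    have hle : ∀ a ∈ V0, ℓ (f a - f (b y) - y • (a - b y)) ≤ 0 := fun a ha => by
      have := add_fderiv_sub_le_of_convexOn_interior hsys.strictConvex.1 hconc.neg hcont.neg hm ha
        (hdf y).neg
      simp only [Pi.neg_apply, neg_apply, ContinuousLinearMap.comp_apply, hleft] at this
      rw [hℓa]
      linarith
    have hbc : ContinuousAt (fun z => ℓ (b' z)) y :=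
      ℓ.continuous.continuousAt.comp (hb.continuousOn_deriv.continuousAt (Ioo_mem_nhds hy.1 hy.2))
    have hev : ∀ᶠ z in 𝓝 y, z ∈ Ioo vL vR ∧ 0 < ℓ (b' z) :=
      (show ∀ᶠ z in 𝓝 y, z ∈ Ioo vL vR from Ioo_mem_nhds hy.1 hy.2).and
        (hbc.eventually (lt_mem_nhds hlt))
    obtain ⟨ε, hε, hball⟩ := Metric.eventually_nhds_iff.1 hev
    have hin : ∀ z ∈ Icc y (y + ε / 2), z ∈ Ioo vL vR ∧ 0 < ℓ (b' z) := fun z hz => hball (by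
      rw [Real.dist_eq, abs_of_nonneg (by linarith [hz.1])]
      linarith [hz.2])
    -- The same gap, evaluated along the wave. Because `(f ∘ b)' = z b'`, its derivative is `(z - y)
    -- ℓ(b' z)`, positive just after `y`, whereas concavity would keep the gap nonpositive.
    let ψ : ℝ → ℝ := fun z => ℓ (f (b z) - f (b y) - y • (b z - b y))
    have hψ : ∀ z ∈ Icc y (y + ε / 2), HasDerivAt ψ ((z - y) * ℓ (b' z)) z := fun z hz => by
      have h1 := hb.hasDerivAt z (hin z hz).1
      have h2 := (hsys.hasFDerivAt_flux (hb.mem z)).comp_hasDerivAt z h1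
      rw [hb.speed z (hin z hz).1] at h2
      have h3 := ℓ.hasFDerivAt.comp_hasDerivAt z
        ((h2.sub_const (f (b y))).sub ((h1.sub_const (b y)).const_smul y))
      rw [← sub_smul, map_smul, smul_eq_mul] at h3
      exact h3
    have hmono : StrictMonoOn ψ (Icc y (y + ε / 2)) := by
      refine strictMonoOn_of_deriv_pos (convex_Icc _ _)
        (fun z hz => (hψ z hz).continuousAt.continuousWithinAt) fun z hz => ?_
      rw [interior_Icc] at hz
      rw [(hψ z (Ioo_subset_Icc_self hz)).deriv]
      exact mul_pos (by linarith [hz.1]) (hin z (Ioo_subset_Icc_self hz)).2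
    have h1 := hmono (left_mem_Icc.2 (by linarith)) (right_mem_Icc.2 (by linarith))
      (show y < y + ε / 2 by linarith)
    have h2 : ψ y = 0 := by simp [ψ]
    have h3 := hle _ (interior_subset (hb.mem (y + ε / 2)))
    rw [h2] at h1
    exact absurd h1 (not_lt.2 h3)

end FanCurve

/-! ### Self-similar integrals and the identity for the profile. -/

section FanIdentity

theorem abs_fanTest_mul_le {ψ A : ℝ → ℝ} {c : ℝ × ℝ → ℝ} {t0 t1 M R C K : ℝ} {p : ℝ × ℝ}
    (h0 : 0 < t0) (hz : ∀ t, t ∉ Icc t0 t1 → ψ t = 0) (hM : ∀ t, t ∈ Icc t0 t1 → |ψ t| ≤ M)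
    (hR : ∀ y, R < |y| → A y = 0) (hC : ∀ y, |A y| ≤ C) (hc : |c p| ≤ K) :
    |fanTest ψ A p * c p| ≤ (fanBox t0 t1 R).indicator (fun _ => M * C * K) p := by
  have hC0 : 0 ≤ C := (abs_nonneg _).trans (hC 0)
  have hK0 : 0 ≤ K := (abs_nonneg _).trans hc
  by_cases ht : p.1 ∈ Icc t0 t1
  · have hM0 : 0 ≤ M := (abs_nonneg _).trans (hM _ ht)
    by_cases hy : |p.2 / p.1| ≤ R
    · rw [indicator_of_mem (mem_fanBox h0 ht hy), fanTest, abs_mul, abs_mul]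
      exact mul_le_mul (mul_le_mul (hM _ ht) (hC _) (abs_nonneg _) hM0) hc (abs_nonneg _)
        (by positivity)
    · rw [fanTest, hR _ (not_le.1 hy), mul_zero, zero_mul, abs_zero]
      exact indicator_apply_nonneg fun _ => by positivity
  · rw [fanTest, hz _ ht, zero_mul, zero_mul, abs_zero, indicator_of_notMem]
    exact fun hmem => ht hmem.1

theorem measurable_fanTest {ψ A : ℝ → ℝ} (hψ : Measurable ψ) (hA : Measurable A) :
    Measurable (fanTest ψ A) := (hψ.comp measurable_fst).mul (hA.comp measurable_ratio)

theorem integrable_fanTest_mul {ψ A : ℝ → ℝ} {c : ℝ × ℝ → ℝ} {t0 t1 M K : ℝ}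
    (hψ : Measurable ψ) (hA : Continuous A) (hAc : HasCompactSupport A)
    (h0 : 0 < t0) (hz : ∀ t, t ∉ Icc t0 t1 → ψ t = 0) (hM : ∀ t, t ∈ Icc t0 t1 → |ψ t| ≤ M)
    (hc : AEStronglyMeasurable c (volume.restrict halfPlane))
    (hcK : ∀ᵐ p ∂(volume.restrict halfPlane), |c p| ≤ K) :
    Integrable (fun p => fanTest ψ A p * c p) (volume.restrict halfPlane) := by
  obtain ⟨C, hC⟩ := hAc.exists_bound_of_continuous hA
  obtain ⟨R, hR⟩ := hAc.isBounded.subset_closedBall 0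
  refine integrable_of_fanBox ((measurable_fanTest hψ hA.measurable).aestronglyMeasurable.mul hc)
    (hcK.mono fun p hp => abs_fanTest_mul_le h0 hz hM (R := R) (fun y hy => ?_) hC hp)
  refine image_eq_zero_of_notMem_tsupport fun hmem => ?_
  have := hR hmem
  rw [mem_closedBall_zero_iff, Real.norm_eq_abs] at this
  linarith

/-- The substitution `x = t y` at fixed time separates the variables and produces the factor `t`. -/
theorem integral_fanTest {ψ A : ℝ → ℝ} (h : Integrable (fanTest ψ A) (volume.restrict halfPlane)) :
    ∫ p in halfPlane, fanTest ψ A p = (∫ t in Ioi 0, ψ t * t) * ∫ y, A y := by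
  rw [volume_restrict_halfPlane] at h ⊢
  rw [integral_prod _ h, ← integral_mul_const]
  refine setIntegral_congr_fun measurableSet_Ioi fun t ht => ?_
  have ht' : 0 < t := ht
  simp only [fanTest]
  rw [integral_const_mul, Measure.integral_comp_div, abs_of_pos ht', smul_eq_mul, mul_assoc]

theorem integral_deriv_eq_zero_of_hasCompactSupport {D : ℝ → ℝ} (hD : ContDiff ℝ 1 D)
    (hc : HasCompactSupport D) : ∫ y, deriv D y = 0 :=
  integral_eq_zero_of_hasDerivAt_of_integrable
    (fun y => (hD.differentiable one_ne_zero y).hasDerivAt)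
    ((hD.continuous_deriv le_rfl).integrable_of_hasCompactSupport hc.deriv)
    (hD.continuous.integrable_of_hasCompactSupport hc)

/-- The weak form of the equation satisfied by a self-similar profile. -/
theorem integral_fanTest_profile {φ A D : ℝ → ℝ} (hφ : ContDiff ℝ ∞ φ) (hφc : HasCompactSupport φ)
    (hs : tsupport φ ⊆ Ioi 0) (hA : Continuous A) (hAc : HasCompactSupport A)
    (hD : ContDiff ℝ 1 D) (hDc : HasCompactSupport D) :
    Integrable (fun p => fanTest (deriv φ) A p + fanTest (fun t => φ t / t)
      (fun y => deriv D y + A y) p) (volume.restrict halfPlane) ∧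
    ∫ p in halfPlane, (fanTest (deriv φ) A p + fanTest (fun t => φ t / t)
      (fun y => deriv D y + A y) p) = 0 := by
  obtain ⟨t0, t1, M, h0, -, hM0, hz, hM⟩ := exists_bounds_of_test hφ hφc hs
  have hD' := hD.continuous_deriv le_rfl
  have i1 : Integrable (fanTest (deriv φ) A) (volume.restrict halfPlane) := by
    simpa using integrable_fanTest_mul (c := fun _ => 1) (K := 1) (measurable_deriv φ) hA hAc h0
      (fun t ht => (hz t ht).2) (fun t _ => (hM t).2) aestronglyMeasurable_const (by simp)
  have i2 : Integrable (fanTest (fun t => φ t / t) (fun y => deriv D y + A y))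
      (volume.restrict halfPlane) := by
    simpa using integrable_fanTest_mul (ψ := fun t => φ t / t) (A := fun y => deriv D y + A y)
      (c := fun _ => 1) (K := 1) (M := M / t0) (t1 := t1) (hφ.continuous.measurable.div measurable_id) (hD'.add hA) (hDc.deriv.add hAc) h0
      (fun t ht => by simp [(hz t ht).1])
      (fun t ht => by
        rw [abs_div, abs_of_pos (h0.trans_le ht.1)]
        exact div_le_div₀ hM0 (hM _).1 h0 ht.1)
      aestronglyMeasurable_const (by simp)
  refine ⟨i1.add i2, ?_⟩
  -- After separation the `D` term integrates to zero, and what is left is `∫ A` times the integral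
  -- of `(t φ)'`.
  rw [integral_add i1 i2, integral_fanTest i1, integral_fanTest i2,
    integral_add (hD'.integrable_of_hasCompactSupport hDc.deriv)
      (hA.integrable_of_hasCompactSupport hAc),
    integral_deriv_eq_zero_of_hasCompactSupport hD hDc, zero_add, ← add_mul]
  have hzero : ∀ t, t ∉ Ioi (0 : ℝ) → φ t = 0 ∧ deriv φ t = 0 := fun t ht =>
    hz t fun h => ht (h0.trans_le h.1)
  have e1 : ∫ t in Ioi 0, deriv φ t * t = ∫ t, deriv φ t * t :=
    setIntegral_eq_integral_of_forall_compl_eq_zero fun t ht => by simp [(hzero t ht).2]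
  have e2 : ∫ t in Ioi 0, φ t / t * t = ∫ t, φ t := by
    rw [← setIntegral_eq_integral_of_forall_compl_eq_zero (s := Ioi 0)
      (fun t ht => (hzero t ht).1)]
    exact setIntegral_congr_fun measurableSet_Ioi fun t ht => div_mul_cancel₀ _ (ne_of_gt ht)
  have hd : ∀ t, HasDerivAt (fun t => φ t * t) (deriv φ t * t + φ t) t := fun t => by
    have h : HasDerivAt (fun t => φ t * t) (deriv φ t * t + φ t * 1) t :=
      (hφ.differentiable (by simp) t).hasDerivAt.mul (hasDerivAt_id t)
    rwa [mul_one] at h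
  have hφ1 : ContDiff ℝ 1 (fun t => φ t * t) := (hφ.of_le (by simp)).mul contDiff_id
  have e3 := integral_deriv_eq_zero_of_hasCompactSupport hφ1 hφc.mul_right
  simp_rw [fun t => (hd t).deriv] at e3
  rw [integral_add] at e3
  · rw [e1, e2, e3, zero_mul]
  · exact ((hφ.continuous_deriv (by simp)).mul continuous_id).integrable_of_hasCompactSupport
      hφc.deriv.mul_right
  · exact hφ.continuous.integrable_of_hasCompactSupport hφc

theorem contDiff_mul_of_tsupport_subset {g H : ℝ → ℝ} {s : Set ℝ} (hs : IsOpen s)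
    (hg : ContDiff ℝ 1 g) (hsub : tsupport g ⊆ s) (hH : ContDiffOn ℝ 1 H s) :
    ContDiff ℝ 1 (fun y => g y * H y) := by
  rw [contDiff_iff_contDiffAt]
  intro y
  by_cases hy : y ∈ tsupport g
  · exact hg.contDiffAt.mul (hH.contDiffAt (hs.mem_nhds (hsub hy)))
  · have : (fun y => g y * H y) =ᶠ[𝓝 y] fun _ => 0 := by
      filter_upwards [notMem_tsupport_iff_eventuallyEq.1 hy] with z hz
      simp [hz]
    exact contDiffAt_const.congr_of_eventuallyEq this

end FanIdentity

/-! ### The relative entropy inequality inside the fan. -/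

section RelativeEntropy

variable {V0 : Set State} {f : State → State} {η q : State → ℝ} {lam : Fin 2 → State → ℝ}
  {vL vR : ℝ} {b b' : ℝ → State} {u : ℝ → ℝ → State}

theorem System.exists_bound (hsys : System V0 f η q lam) :
    ∃ K : ℝ, 0 ≤ K ∧ ∀ a ∈ V0, ‖a‖ ≤ K ∧ ‖f a‖ ≤ K ∧ |η a| ≤ K ∧ |q a| ≤ K := by
  obtain ⟨K1, h1⟩ := hsys.bounded.exists_norm_le
  obtain ⟨K2, h2⟩ := hsys.flux_bounded.exists_norm_le
  obtain ⟨K3, h3⟩ := hsys.entropy_bounded.exists_norm_le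
  obtain ⟨K4, h4⟩ := hsys.entropyFlux_bounded.exists_norm_le
  refine ⟨|K1| + |K2| + |K3| + |K4|, by positivity, fun a ha => ⟨?_, ?_, ?_, ?_⟩⟩
  · linarith [h1 a ha, le_abs_self K1, abs_nonneg K2, abs_nonneg K3, abs_nonneg K4]
  · linarith [h2 _ (mem_image_of_mem f ha), le_abs_self K2, abs_nonneg K1, abs_nonneg K3,
      abs_nonneg K4]
  · have := h3 _ (mem_image_of_mem η ha)
    rw [Real.norm_eq_abs] at this
    linarith [le_abs_self K3, abs_nonneg K1, abs_nonneg K2, abs_nonneg K4]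
  · have := h4 _ (mem_image_of_mem q ha)
    rw [Real.norm_eq_abs] at this
    linarith [le_abs_self K4, abs_nonneg K1, abs_nonneg K2, abs_nonneg K3]

theorem System.continuousOn_fderiv_entropy (hsys : System V0 f η q lam) :
    ContinuousOn (fderiv ℝ η) (interior V0) := fun _ ha =>
  (hsys.hasFDerivAt_fderiv_entropy ha).continuousAt.continuousWithinAt

theorem IsFanCurve.continuous_fderiv_entropy (hb : IsFanCurve V0 f vL vR b b')
    (hsys : System V0 f η q lam) : Continuous fun y => fderiv ℝ η (b y) :=
  hsys.continuousOn_fderiv_entropy.comp_continuous hb.continuous hb.mem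

/-- Joint continuity in the state and in `y` serves twice: for measurability along the solution and
for the passage to the traces. -/
theorem IsFanCurve.continuousOn_relEntropy (hb : IsFanCurve V0 f vL vR b b')
    (hsys : System V0 f η q lam) :
    ContinuousOn (fun p : State × ℝ => relEntropy η p.1 (b p.2)) (V0 ×ˢ univ) := by
  have h1 : ContinuousOn (fun p : State × ℝ => η p.1) (V0 ×ˢ univ) :=
    hsys.entropy_continuous.comp continuousOn_fst fun p hp => hp.1
  have h2 : Continuous fun p : State × ℝ => η (b p.2) :=
    (hsys.entropy_continuous.comp_continuous hb.continuous fun y => interior_subset (hb.mem y)).comp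
      continuous_snd
  have h3 : Continuous fun p : State × ℝ => fderiv ℝ η (b p.2) (p.1 - b p.2) :=
    ((hb.continuous_fderiv_entropy hsys).comp continuous_snd).clm_apply
      (continuous_fst.sub (hb.continuous.comp continuous_snd))
  exact (h1.sub h2.continuousOn).sub h3.continuousOn

theorem IsFanCurve.continuousOn_relFlux (hb : IsFanCurve V0 f vL vR b b')
    (hsys : System V0 f η q lam) :
    ContinuousOn (fun p : State × ℝ => relFlux f η q p.1 (b p.2)) (V0 ×ˢ univ) := by
  have h1 : ContinuousOn (fun p : State × ℝ => q p.1) (V0 ×ˢ univ) :=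
    hsys.entropyFlux_continuous.comp continuousOn_fst fun p hp => hp.1
  have h1' : ContinuousOn (fun p : State × ℝ => f p.1) (V0 ×ˢ univ) :=
    hsys.flux_continuous.comp continuousOn_fst fun p hp => hp.1
  have h2 : Continuous fun p : State × ℝ => q (b p.2) :=
    (hsys.entropyFlux_continuous.comp_continuous hb.continuous
      fun y => interior_subset (hb.mem y)).comp continuous_snd
  have h2' : Continuous fun p : State × ℝ => f (b p.2) :=
    (hsys.flux_continuous.comp_continuous hb.continuous
      fun y => interior_subset (hb.mem y)).comp continuous_snd
  have h3 : ContinuousOn (fun p : State × ℝ => fderiv ℝ η (b p.2) (f p.1 - f (b p.2)))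
      (V0 ×ˢ univ) :=
    ((hb.continuous_fderiv_entropy hsys).comp continuous_snd).continuousOn.clm_apply
      (h1'.sub h2'.continuousOn)
  exact (h1.sub h2.continuousOn).sub h3

/-- The range of the curve is compact in the interior, so `η'` is bounded along it, although it may
blow up at the boundary of `V0`. -/
theorem IsFanCurve.exists_bound (hb : IsFanCurve V0 f vL vR b b') (hsys : System V0 f η q lam) :
    ∃ C : ℝ, 0 ≤ C ∧ ∀ a ∈ V0, ∀ y, |relEntropy η a (b y)| ≤ C ∧ |relFlux f η q a (b y)| ≤ C := by
  obtain ⟨K, hK0, hK⟩ := hsys.exists_bound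
  obtain ⟨C, hC⟩ := (hb.isCompact_range.image_of_continuousOn
    (hsys.continuousOn_fderiv_entropy.mono (range_subset_iff.2 hb.mem))).isBounded.exists_norm_le
  have hC' : ∀ y, ‖fderiv ℝ η (b y)‖ ≤ C := fun y => hC _ (mem_image_of_mem _ (mem_range_self y))
  have hC0 : 0 ≤ C := (norm_nonneg _).trans (hC' 0)
  have aux : ∀ (y : ℝ) (v w : State), ‖v‖ ≤ K → ‖w‖ ≤ K → |fderiv ℝ η (b y) (v - w)| ≤ C * (K + K) :=
    fun y v w hv hw => ((fderiv ℝ η (b y)).le_opNorm _).trans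
      (mul_le_mul (hC' y) ((norm_sub_le _ _).trans (add_le_add hv hw)) (norm_nonneg _) hC0)
  refine ⟨K + K + C * (K + K), by positivity, fun a ha y => ?_⟩
  obtain ⟨a1, a2, a3, a4⟩ := hK a ha
  obtain ⟨b1, b2, b3, b4⟩ := hK _ (interior_subset (hb.mem y))
  exact ⟨(abs_sub _ _).trans (add_le_add ((abs_sub _ _).trans (add_le_add a3 b3)) (aux y _ _ a1 b1)),
    (abs_sub _ _).trans (add_le_add ((abs_sub _ _).trans (add_le_add a4 b4)) (aux y _ _ a2 b2))⟩

/-- Used to recombine the two scalar weak equations into the pairing with `η'(b)`. -/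
theorem apply_eq_sum_single (ℓ : State →L[ℝ] ℝ) (a : State) :
    ℓ a = ℓ (EuclideanSpace.single 0 1) * a 0 + ℓ (EuclideanSpace.single 1 1) * a 1 := by
  have h : a = ∑ k, a k • EuclideanSpace.single k (1 : ℝ) := by
    have := (EuclideanSpace.basisFun (Fin 2) ℝ).sum_repr a
    simpa using this.symm
  conv_lhs => rw [h]
  simp [Fin.sum_univ_two, mul_comm]

theorem aestronglyMeasurable_relEntropy_comp {Ω : Type*} [MeasurableSpace Ω] {μ : Measure Ω}
    (hb : IsFanCurve V0 f vL vR b b') (hsys : System V0 f η q lam) {w : Ω → State} {y : Ω → ℝ}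
    (hw : AEStronglyMeasurable w μ) (hy : AEStronglyMeasurable y μ) (hV : ∀ᵐ p ∂μ, w p ∈ V0) :
    AEStronglyMeasurable (fun p => relEntropy η (w p) (b (y p))) μ :=
  (hb.continuousOn_relEntropy hsys).aestronglyMeasurable_comp (hw.prodMk hy)
    (hV.mono fun _ hp => ⟨hp, mem_univ _⟩)

theorem aestronglyMeasurable_relFlux_comp {Ω : Type*} [MeasurableSpace Ω] {μ : Measure Ω}
    (hb : IsFanCurve V0 f vL vR b b') (hsys : System V0 f η q lam) {w : Ω → State} {y : Ω → ℝ}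
    (hw : AEStronglyMeasurable w μ) (hy : AEStronglyMeasurable y μ) (hV : ∀ᵐ p ∂μ, w p ∈ V0) :
    AEStronglyMeasurable (fun p => relFlux f η q (w p) (b (y p))) μ :=
  (hb.continuousOn_relFlux hsys).aestronglyMeasurable_comp (hw.prodMk hy)
    (hV.mono fun _ hp => ⟨hp, mem_univ _⟩)

theorem IsFanCurve.contDiffOn (hb : IsFanCurve V0 f vL vR b b') : ContDiffOn ℝ 1 b (Ioo vL vR) := by
  rw [show (1 : ℕ∞ω) = 0 + 1 by norm_num, contDiffOn_succ_iff_deriv_of_isOpen isOpen_Ioo]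
  refine ⟨fun y hy => (hb.hasDerivAt y hy).differentiableAt.differentiableWithinAt, by simp, ?_⟩
  rw [contDiffOn_zero]
  exact hb.continuousOn_deriv.congr fun y hy => (hb.hasDerivAt y hy).deriv

/-- The relative entropy inequality for a solution and a rarefaction wave, tested by
`φ(t) g(x/t)` with `g` supported in the fan. -/
theorem IsFanCurve.relEntropy_inequality (hb : IsFanCurve V0 f vL vR b b')
    (hsys : System V0 f η q lam) (hu : u ∈ weakSolutions V0 f η q) {φ g : ℝ → ℝ}
    (hφ : ContDiff ℝ ∞ φ) (hφc : HasCompactSupport φ) (hs : tsupport φ ⊆ Ioi 0) (hφ0 : ∀ t, 0 ≤ φ t)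
    (hg : ContDiff ℝ ∞ g) (hgs : tsupport g ⊆ Ioo vL vR) (hg0 : ∀ y, 0 ≤ g y) :
    -(∫ p in halfPlane, fanTest (deriv φ) g p * relEntropy η (u p.1 p.2) (b (p.2 / p.1))) ≤
      ∫ p in halfPlane, fanTest (fun t => φ t / t) (deriv g) p *
        (relFlux f η q (u p.1 p.2) (b (p.2 / p.1))
          - p.2 / p.1 * relEntropy η (u p.1 p.2) (b (p.2 / p.1))) := by
  obtain ⟨hum, huV, ⟨u0, -, -, hweak, hentr⟩, -⟩ := hu
  obtain ⟨K, hK0, hK⟩ := hsys.exists_bound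
  obtain ⟨C, hC0, hC⟩ := hb.exists_bound hsys
  obtain ⟨t0, t1, M, h0, -, hM0, hz, hM⟩ := exists_bounds_of_test hφ hφc hs
  have hum : AEStronglyMeasurable (fun p : ℝ × ℝ => u p.1 p.2) (volume.restrict halfPlane) := hum
  have hgc : HasCompactSupport g :=
    HasCompactSupport.of_support_subset_isCompact isCompact_Icc
      ((subset_tsupport g).trans (hgs.trans Ioo_subset_Icc_self))
  have hg1 : ContDiff ℝ 1 g := hg.of_le (by simp)
  have hfm := hsys.flux_continuous.aestronglyMeasurable_comp hum huV
  have hηm := hsys.entropy_continuous.aestronglyMeasurable_comp hum huV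
  have hqm := hsys.entropyFlux_continuous.aestronglyMeasurable_comp hum huV
  -- the profile
  have hH : ContDiffOn ℝ 1 (fun y => fderiv ℝ η (b y)) (Ioo vL vR) :=
    ((hsys.entropy_smooth.fderiv_of_isOpen isOpen_interior (m := 1) (by norm_num)).comp
      hb.contDiffOn fun y _ => hb.mem y)
  have hηb : ContDiffOn ℝ 1 (fun y => η (b y)) (Ioo vL vR) :=
    (hsys.entropy_smooth.of_le (by norm_num)).comp hb.contDiffOn fun y _ => hb.mem y
  have hqb : ContDiffOn ℝ 1 (fun y => q (b y)) (Ioo vL vR) :=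
    (hsys.entropyFlux_smooth.of_le (by norm_num)).comp hb.contDiffOn fun y _ => hb.mem y
  have hfb : ContDiffOn ℝ 1 (fun y => f (b y)) (Ioo vL vR) :=
    (hsys.flux_smooth.of_le (by norm_num)).comp hb.contDiffOn fun y _ => hb.mem y
  -- `P` and `Q` collect the parts free of `u`: `η(u|b) = η(u) - η'(b) u - P`, and `q(u;b) - y
  -- η(u|b) = q(u) - y η(u) - η'(b)(f(u) - y u) - Q`.
  let Q : ℝ → ℝ := fun y => q (b y) - y * η (b y) - fderiv ℝ η (b y) (f (b y) - y • b y)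
  let P : ℝ → ℝ := fun y => η (b y) - fderiv ℝ η (b y) (b y)
  let ℓ : ℝ → State →L[ℝ] ℝ := fun y => fderiv ℝ (fderiv ℝ η) (b y) (b' y)
  have hQ : ContDiffOn ℝ 1 Q (Ioo vL vR) :=
    (hqb.sub (contDiffOn_id.mul hηb)).sub
      (hH.clm_apply (hfb.sub (contDiffOn_id.smul hb.contDiffOn)))
  have hP : ContDiffOn ℝ 1 P (Ioo vL vR) := hηb.sub (hH.clm_apply hb.contDiffOn)
  have hHd : ∀ y ∈ Ioo vL vR, HasDerivAt (fun y => fderiv ℝ η (b y)) (ℓ y) y := fun y hy =>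
    (hsys.hasFDerivAt_fderiv_entropy (hb.mem y)).comp_hasDerivAt y (hb.hasDerivAt y hy)
  -- With `q' = η' f'` and `f' b' = y b'`, every term containing `η' b'` cancels.
  have hQd : ∀ y ∈ Ioo vL vR, HasDerivAt Q (-P y - ℓ y (f (b y) - y • b y)) y := fun y hy => by
    have h1 := hb.hasDerivAt y hy
    have hη := (hsys.hasFDerivAt_entropy (hb.mem y)).comp_hasDerivAt y h1
    have hq := (hsys.hasFDerivAt_entropyFlux (hb.mem y)).comp_hasDerivAt y h1
    have hf := (hsys.hasFDerivAt_flux (hb.mem y)).comp_hasDerivAt y h1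
    have h2 := (hq.sub ((hasDerivAt_id y).mul hη)).sub
      ((hHd y hy).clm_apply (hf.sub ((hasDerivAt_id y).smul h1)))
    refine h2.congr_deriv ?_
    rw [hsys.compatible _ (hb.mem y), ContinuousLinearMap.comp_apply, hb.speed y hy]
    simp [P]
    ring
  -- the three weak forms
  let h : Fin 2 → ℝ → ℝ := fun k y => g y * fderiv ℝ η (b y) (EuclideanSpace.single k 1)
  have hh : ∀ k, ContDiff ℝ 1 (h k) := fun k =>
    contDiff_mul_of_tsupport_subset isOpen_Ioo hg1 hgs (hH.clm_apply contDiffOn_const)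
  have hE := hentr.integral_fanIntegrand_nonneg hφ hφc hs hφ0 hg hgc hg0
  have hW := fun k => hweak.integral_fanIntegrand_eq_zero hum hfm
    (huV.mono fun p hp => (hK _ hp).1) (huV.mono fun p hp => (hK _ hp).2.1) hφ hφc hs (hh k)
    hgc.mul_right k
  obtain ⟨iB, hB⟩ := integral_fanTest_profile (A := fun y => g y * P y) (D := fun y => g y * Q y)
    hφ hφc hs (contDiff_mul_of_tsupport_subset isOpen_Ioo hg1 hgs hP).continuous hgc.mul_right
    (contDiff_mul_of_tsupport_subset isOpen_Ioo hg1 hgs hQ) hgc.mul_right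
  have iE := integrable_fanIntegrand hφ hφc hs hg1 hgc hηm hqm
    (huV.mono fun p hp => (hK _ hp).2.2.1) (huV.mono fun p hp => (hK _ hp).2.2.2)
  have hcomp : ∀ {w : ℝ × ℝ → State}, AEStronglyMeasurable w (volume.restrict halfPlane) →
      ∀ k, AEStronglyMeasurable (fun p => w p k) (volume.restrict halfPlane) := fun hw k =>
    (EuclideanSpace.proj k : State →L[ℝ] ℝ).continuous.comp_aestronglyMeasurable hw
  have iW := fun k => integrable_fanIntegrand hφ hφc hs (hh k) hgc.mul_right (hcomp hum k)
    (hcomp hfm k) (huV.mono fun p hp => (PiLp.norm_apply_le (u p.1 p.2) k).trans (hK _ hp).1)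
    (huV.mono fun p hp => (PiLp.norm_apply_le (f (u p.1 p.2)) k).trans (hK _ hp).2.1)
  -- the relative quantities
  have hrm := aestronglyMeasurable_relEntropy_comp hb hsys hum
    measurable_ratio.aestronglyMeasurable huV
  have hrfm := aestronglyMeasurable_relFlux_comp hb hsys hum
    measurable_ratio.aestronglyMeasurable huV
  have hφt : Measurable fun t => φ t / t := hφ.continuous.measurable.div measurable_id
  have hφtz : ∀ t, t ∉ Icc t0 t1 → φ t / t = 0 := fun t ht => by simp [(hz t ht).1]
  have hφtM : ∀ t, t ∈ Icc t0 t1 → |φ t / t| ≤ M / t0 := fun t ht => by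
    rw [abs_div, abs_of_pos (h0.trans_le ht.1)]
    exact div_le_div₀ hM0 (hM _).1 h0 ht.1
  have iX := integrable_fanTest_mul (measurable_deriv φ) hg.continuous hgc h0
    (fun t ht => (hz t ht).2) (fun t _ => (hM t).2) hrm (huV.mono fun p hp => (hC _ hp _).1)
  have hg' : Continuous (deriv g) := hg1.continuous_deriv le_rfl
  have iY1 := integrable_fanTest_mul hφt hg' hgc.deriv h0 hφtz hφtM hrfm
    (huV.mono fun p hp => (hC _ hp _).2)
  -- The unbounded factor `y` is absorbed into the compactly supported profile `y g'`.
  have iY2 := integrable_fanTest_mul hφt (continuous_id.mul hg') hgc.deriv.mul_left h0 hφtz hφtM hrm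
    (huV.mono fun p hp => (hC _ hp _).1)
  have iY : Integrable (fun p : ℝ × ℝ => fanTest (fun t => φ t / t) (deriv g) p *
        (relFlux f η q (u p.1 p.2) (b (p.2 / p.1))
          - p.2 / p.1 * relEntropy η (u p.1 p.2) (b (p.2 / p.1)))) (volume.restrict halfPlane) := by
    refine (iY1.sub iY2).congr (Eventually.of_forall fun p => ?_)
    simp only [fanTest, Pi.sub_apply, Pi.mul_apply, id]
    ring
  have hmain : 0 ≤ ∫ p in halfPlane, (fanTest (deriv φ) g p *
      relEntropy η (u p.1 p.2) (b (p.2 / p.1)) + fanTest (fun t => φ t / t) (deriv g) p *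
        (relFlux f η q (u p.1 p.2) (b (p.2 / p.1))
          - p.2 / p.1 * relEntropy η (u p.1 p.2) (b (p.2 / p.1)))) := by
    -- Entropy inequality minus the two component equations minus the profile identity; pointwise
    -- this combination is the desired integrand minus the nonnegative source.
    have hI := integral_sub ((iE.sub (iW 0)).sub (iW 1)) iB
    rw [hB, integral_sub' (iE.sub (iW 0)) (iW 1), integral_sub' iE (iW 0), hW 0, hW 1] at hI
    simp only [sub_zero] at hI
    refine (hE.trans_eq hI.symm).trans (integral_mono_ae (((iE.sub (iW 0)).sub (iW 1)).sub iB)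
      (iX.add iY) ?_)
    filter_upwards [ae_halfPlane_pos, huV] with p hp hpV
    simp only [Pi.sub_apply, fanIntegrand, fanTest]
    generalize p.2 / p.1 = y
    generalize hr : u p.1 p.2 = a at hpV ⊢
    -- Inside the fan the difference of the two integrands is exactly the source; outside,
    -- everything vanishes with `g` and its derivative.
    by_cases hy : y ∈ Ioo vL vR
    · have hsrc := hb.source_nonneg hsys hy hpV
      have hgd := (hg1.differentiable one_ne_zero y).hasDerivAt
      have d1 : ∀ k, deriv (h k) y = deriv g y * fderiv ℝ η (b y) (EuclideanSpace.single k 1)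
          + g y * ℓ y (EuclideanSpace.single k 1) := fun k =>
        (hgd.mul ((ContinuousLinearMap.apply ℝ ℝ
          (EuclideanSpace.single k (1 : ℝ) : State)).hasFDerivAt.comp_hasDerivAt y (hHd y hy))).deriv
      have d2 : deriv (fun y => g y * Q y) y =
          deriv g y * Q y + g y * (-P y - ℓ y (f (b y) - y • b y)) := (hgd.mul (hQd y hy)).deriv
      have e1 := apply_eq_sum_single (fderiv ℝ η (b y)) a
      have e2 := apply_eq_sum_single (fderiv ℝ η (b y)) (f a)
      have e3 := apply_eq_sum_single (ℓ y) a
      have e4 := apply_eq_sum_single (ℓ y) (f a)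
      have hsrc' : 0 ≤ φ p.1 / p.1 * g y * (ℓ y (f a) - ℓ y (f (b y)) - y * (ℓ y a - ℓ y (b y))) := by
        refine mul_nonneg (mul_nonneg (div_nonneg (hφ0 _) hp.le) (hg0 _)) ?_
        simpa using hsrc
      rw [d1, d1, d2]
      simp only [h, Q, P, relEntropy, relFlux, map_sub, map_smul, smul_eq_mul]
      rw [e3, e4] at hsrc'
      rw [e1, e2]
      linarith
    · have hyt : y ∉ tsupport g := fun h => hy (hgs h)
      have z1 : g y = 0 := image_eq_zero_of_notMem_tsupport hyt
      have z2 : ∀ H : ℝ → ℝ, deriv (fun y => g y * H y) y = 0 := fun H => by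
        have : (fun y => g y * H y) =ᶠ[𝓝 y] fun _ => 0 := by
          filter_upwards [notMem_tsupport_iff_eventuallyEq.1 hyt] with z hz
          simp [hz]
        rw [this.deriv_eq, deriv_const]
      have z3 : deriv g y = 0 := by simpa using z2 fun _ => 1
      have z4 : ∀ k, deriv (h k) y = 0 := fun k => z2 _
      rw [z4, z4, z2, z3]
      simp [h, z1]
  rw [integral_add iX iY] at hmain
  linarith

end RelativeEntropy

/-! ### Strong traces as limits of concentrating test functions. -/

section Trace

/-- The shear `(t, s) ↦ (t, v t + κ s)` of the half plane. -/
theorem measurePreserving_shear (v : ℝ) {κ : ℝ} (hκ : κ ≠ 0) :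
    MeasurePreserving (fun p : ℝ × ℝ => (p.1, v * p.1 + κ * p.2)) (volume.restrict halfPlane)
      (ENNReal.ofReal |κ⁻¹| • volume.restrict halfPlane) := by
  rw [volume_restrict_halfPlane, ← Measure.prod_smul_right]
  refine (MeasurePreserving.id _).skew_product (g := fun t s => v * t + κ * s)
    (by unfold Function.uncurry; fun_prop) (ae_of_all _ fun t => ?_)
  have h1 : (fun s => v * t + κ * s) = (fun s => v * t + s) ∘ fun s => κ * s := rfl
  rw [h1, ← Measure.map_map (by fun_prop) (by fun_prop), Real.map_volume_mul_left hκ,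
    Measure.map_smul, map_add_left_eq_self]

theorem quasiMeasurePreserving_shear (v : ℝ) {κ : ℝ} (hκ : κ ≠ 0) :
    Measure.QuasiMeasurePreserving (fun p : ℝ × ℝ => (p.1, v * p.1 + κ * p.2))
      (volume.restrict halfPlane) (volume.restrict halfPlane) :=
  (measurePreserving_shear v hκ).quasiMeasurePreserving.mono_right
    (Measure.smul_absolutelyContinuous)

theorem integral_comp_shear (v : ℝ) {κ : ℝ} (hκ : κ ≠ 0) {F : ℝ × ℝ → ℝ}
    (hF : AEStronglyMeasurable F (volume.restrict halfPlane)) :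
    ∫ p in halfPlane, F p = |κ| * ∫ p in halfPlane, F (p.1, v * p.1 + κ * p.2) := by
  have h := measurePreserving_shear v hκ
  have hF' : AEStronglyMeasurable F (Measure.map (fun p : ℝ × ℝ => (p.1, v * p.1 + κ * p.2))
      (volume.restrict halfPlane)) := by
    rw [h.map_eq]
    exact hF.mono_ac Measure.smul_absolutelyContinuous
  have := integral_map h.measurable.aemeasurable hF'
  rw [h.map_eq, integral_smul_measure, ENNReal.toReal_ofReal (abs_nonneg _)] at this
  rw [← this, smul_eq_mul, ← mul_assoc, ← abs_mul, mul_inv_cancel₀ hκ, abs_one, one_mul]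

/-- Scaling by a nonzero factor preserves null sets and `(0, 1)` has measure one, so a mean over the
rescaled layer is at most the essential supremum. -/
theorem lintegral_comp_mul_le_essSup {F : ℝ → ℝ≥0∞} {κ : ℝ} (hκ : κ ≠ 0) {I : Set ℝ}
    (hI : MeasurableSet I) (hmaps : ∀ s ∈ Ioo (0 : ℝ) 1, κ * s ∈ I) :
    ∫⁻ s in Ioo (0 : ℝ) 1, F (κ * s) ≤ essSup F (volume.restrict I) := by
  have h1 : ∀ᵐ y, y ∈ I → F y ≤ essSup F (volume.restrict I) :=
    (ae_restrict_iff' hI).1 (ae_le_essSup (by isBoundedDefault))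
  have h2 : ∀ᵐ s : ℝ, κ * s ∈ I → F (κ * s) ≤ essSup F (volume.restrict I) := by
    rw [ae_iff] at h1 ⊢
    have := Real.volume_preimage_mul_left hκ
      {y | ¬(y ∈ I → F y ≤ essSup F (volume.restrict I))}
    rw [h1, mul_zero] at this
    exact this
  calc ∫⁻ s in Ioo (0 : ℝ) 1, F (κ * s)
      ≤ ∫⁻ _ in Ioo (0 : ℝ) 1, essSup F (volume.restrict I) := by
        refine lintegral_mono_ae ((ae_restrict_iff' measurableSet_Ioo).2 ?_)
        filter_upwards [h2] with s hs hs' using hs (hmaps s hs')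
    _ = essSup F (volume.restrict I) := by simp

/-- Convergence in mean of `u` to `w` at distance `O(1/n)` of the line `x = v t`, on the side given
by the sign of `σ`. -/
def HasMeanTrace (u : ℝ → ℝ → State) (v σ : ℝ) (w : ℝ → State) : Prop :=
  ∀ T : ℝ, 0 < T → Tendsto (fun n : ℕ => ∫⁻ t in Ioo 0 T, ∫⁻ s in Ioo (0 : ℝ) 1,
    ‖u t (v * t + σ / n * s) - w t‖ₑ) atTop (𝓝 0)

theorem IsRightTrace.hasMeanTrace {u : ℝ → ℝ → State} {v : ℝ} {w : ℝ → State}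
    (h : IsRightTrace u (fun t => v * t) w) : HasMeanTrace u v 1 w := fun T hT => by
  refine tendsto_of_tendsto_of_tendsto_of_le_of_le' tendsto_const_nhds (h.2 T hT)
    (Eventually.of_forall fun _ => zero_le) ?_
  -- For `n = 0` the convention `1 / 0 = 0` collapses the layer.
  filter_upwards [eventually_gt_atTop 0] with n hn
  have hn' : (0 : ℝ) < n := Nat.cast_pos.2 hn
  refine lintegral_mono fun t => ?_
  exact lintegral_comp_mul_le_essSup (F := fun y => ‖u t (v * t + y) - w t‖ₑ)
    (one_div_pos.2 hn').ne' measurableSet_Ioo fun s hs =>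
      ⟨mul_pos (one_div_pos.2 hn') hs.1, mul_lt_of_lt_one_right (one_div_pos.2 hn') hs.2⟩

theorem IsLeftTrace.hasMeanTrace {u : ℝ → ℝ → State} {v : ℝ} {w : ℝ → State}
    (h : IsLeftTrace u (fun t => v * t) w) : HasMeanTrace u v (-1) w := fun T hT => by
  refine tendsto_of_tendsto_of_tendsto_of_le_of_le' tendsto_const_nhds (h.2 T hT)
    (Eventually.of_forall fun _ => zero_le) ?_
  filter_upwards [eventually_gt_atTop 0] with n hn
  have hn' : (0 : ℝ) < 1 / n := one_div_pos.2 (Nat.cast_pos.2 hn)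
  refine lintegral_mono fun t => ?_
  refine lintegral_comp_mul_le_essSup (F := fun y => ‖u t (v * t + y) - w t‖ₑ)
    (by rw [neg_div]; exact (neg_lt_zero.2 hn').ne) measurableSet_Ioo fun s hs => ?_
  have := mul_pos hn' hs.1
  have := mul_lt_of_lt_one_right hn' hs.2
  rw [neg_div]
  constructor <;> linarith

variable {V0 : Set State} {u : ℝ → ℝ → State} {w : ℝ → State} {v σ : ℝ}

theorem volume_restrict_Ioo_prod (T : ℝ) :
    (volume : Measure (ℝ × ℝ)).restrict (Ioo 0 T ×ˢ Ioo 0 1) =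
      (volume.restrict (Ioo 0 T)).prod (volume.restrict (Ioo 0 1)) := by
  rw [Measure.volume_eq_prod, ← Measure.prod_restrict]

theorem Ioo_prod_subset_halfPlane (T : ℝ) : Ioo 0 T ×ˢ Ioo (0 : ℝ) 1 ⊆ halfPlane :=
  Set.prod_mono Ioo_subset_Ioi_self (subset_univ _)

/-- The iterated integral in `HasMeanTrace` is the `L¹` distance on the product, and `L¹`
convergence implies convergence in measure. The shift to `n + 1` keeps the shear invertible. -/
theorem HasMeanTrace.tendstoInMeasure (h : HasMeanTrace u v σ w) (hσ : σ ≠ 0)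
    (hu : AEStronglyMeasurable (fun p : ℝ × ℝ => u p.1 p.2) (volume.restrict halfPlane))
    (hw : AEStronglyMeasurable w (volume.restrict (Ioi 0))) {T : ℝ} (hT : 0 < T) :
    TendstoInMeasure (volume.restrict (Ioo 0 T ×ˢ Ioo (0 : ℝ) 1))
      (fun (n : ℕ) (p : ℝ × ℝ) => u p.1 (v * p.1 + σ / ((n + 1 : ℕ) : ℝ) * p.2)) atTop
      (fun p => w p.1) := by
  have hm : ∀ n : ℕ, AEStronglyMeasurable
      (fun p : ℝ × ℝ => u p.1 (v * p.1 + σ / ((n + 1 : ℕ) : ℝ) * p.2))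
      (volume.restrict (Ioo 0 T ×ˢ Ioo (0 : ℝ) 1)) := fun n =>
    (hu.comp_quasiMeasurePreserving (quasiMeasurePreserving_shear v
      (div_ne_zero hσ (by positivity)))).mono_measure
      (Measure.restrict_mono (Ioo_prod_subset_halfPlane T) le_rfl)
  have hw' : AEStronglyMeasurable (fun p : ℝ × ℝ => w p.1)
      (volume.restrict (Ioo 0 T ×ˢ Ioo (0 : ℝ) 1)) := by
    rw [volume_restrict_Ioo_prod]
    exact (hw.mono_measure (Measure.restrict_mono Ioo_subset_Ioi_self le_rfl)).comp_fst
  refine tendstoInMeasure_of_tendsto_eLpNorm one_ne_zero hm hw' ?_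
  refine ((h T hT).comp (tendsto_add_atTop_nat 1)).congr fun n => ?_
  have hmn := ((hm n).sub hw').enorm
  rw [eLpNorm_one_eq_lintegral_enorm]
  rw [volume_restrict_Ioo_prod] at hmn ⊢
  rw [lintegral_prod _ hmn]
  rfl

/-- Concentrating test functions on the side `σ` of the line `x = v t` produces the trace of a
nonlinear function of the solution. -/
theorem HasMeanTrace.tendsto_integral (h : HasMeanTrace u v σ w) (hσ : σ = 1 ∨ σ = -1)
    (hu : AEStronglyMeasurable (fun p : ℝ × ℝ => u p.1 p.2) (volume.restrict halfPlane))
    (huV : ∀ᵐ p : ℝ × ℝ ∂(volume.restrict halfPlane), u p.1 p.2 ∈ V0)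
    (hw : AEStronglyMeasurable w (volume.restrict (Ioi 0)))
    (hwV : ∀ᵐ t ∂(volume.restrict (Ioi (0 : ℝ))), w t ∈ V0)
    {G : State → ℝ → ℝ} {C : ℝ} (hG : ContinuousOn (fun p : State × ℝ => G p.1 p.2) (V0 ×ˢ univ))
    (hC0 : 0 ≤ C) (hGC : ∀ a ∈ V0, ∀ y, |G a y| ≤ C * (1 + |y|))
    {φ k : ℝ → ℝ} {t0 t1 M : ℝ} (hφ : Continuous φ) (h0 : 0 < t0) (h01 : t0 < t1)
    (hz : ∀ t, t ∉ Icc t0 t1 → φ t = 0) (hM : ∀ t, |φ t| ≤ M)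
    (hk : Continuous k) (hk0 : ∀ r, r ∉ Ioo (0 : ℝ) 1 → k r = 0) (hk1 : ∫ r, k r = 1) :
    Tendsto (fun n : ℕ => ∫ p in halfPlane, fanTest (fun t => φ t / t)
      (fun y => σ * (((n + 1 : ℕ) : ℝ) * t1) * k (σ * (((n + 1 : ℕ) : ℝ) * t1) * (y - v))) p *
        G (u p.1 p.2) (p.2 / p.1)) atTop (𝓝 (σ * ∫ t, φ t * G (w t) v)) := by
  have hσ0 : σ ≠ 0 := by rcases hσ with rfl | rfl <;> norm_num
  have hσ2 : σ * σ = 1 := by rcases hσ with rfl | rfl <;> norm_num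
  have hσa : |σ| = 1 := by rcases hσ with rfl | rfl <;> simp
  have ht1 : 0 < t1 := h0.trans h01
  have hM0 : 0 ≤ M := (abs_nonneg _).trans (hM 0)
  set T : ℝ := t1 + 1 with hT
  set Ω : Set (ℝ × ℝ) := Ioo 0 T ×ˢ Ioo (0 : ℝ) 1 with hΩ
  have hΩm : MeasurableSet Ω := measurableSet_Ioo.prod measurableSet_Ioo
  have hΩh : Ω ⊆ halfPlane := Ioo_prod_subset_halfPlane T
  let κ : ℕ → ℝ := fun n => σ / ((n + 1 : ℕ) : ℝ)
  have hκ : ∀ n, κ n ≠ 0 := fun n => div_ne_zero hσ0 (by positivity)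
  have hκ1 : ∀ n, |κ n| ≤ 1 := fun n => by
    simp only [κ]
    rw [abs_div, hσa, abs_of_pos (by positivity : (0 : ℝ) < ((n + 1 : ℕ) : ℝ))]
    rw [div_le_one (by positivity)]
    push_cast
    linarith [n.cast_nonneg (α := ℝ)]
  -- The kernel in the sheared coordinates `x = v t + σ s / (n + 1)`: the Jacobian cancels the
  -- factor `n + 1`, so `J` no longer depends on `n`.
  let J : ℝ × ℝ → ℝ := fun p => φ p.1 * t1 / p.1 * k (t1 * p.2 / p.1)
  have hJm : Measurable J := by
    have := hφ.measurable
    have := hk.measurable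
    fun_prop
  have hJ0 : ∀ p : ℝ × ℝ, p ∉ Icc t0 t1 ×ˢ Ioo (0 : ℝ) 1 → J p = 0 := fun p hp => by
    by_cases ht : p.1 ∈ Icc t0 t1
    · have hp0 : 0 < p.1 := h0.trans_le ht.1
      have : t1 * p.2 / p.1 ∉ Ioo (0 : ℝ) 1 := fun hr => hp ⟨ht, by
        have h1 : 0 < t1 * p.2 := by
          have := mul_pos hr.1 hp0
          rwa [div_mul_cancel₀ _ hp0.ne'] at this
        exact pos_of_mul_pos_right h1 ht1.le, by
        -- Here `t1 s < t ≤ t1` forces `s < 1`; this is why `t1` enters the concentration rate.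
        have h1 := (div_lt_one hp0).1 hr.2
        by_contra hge
        nlinarith [ht.2, not_lt.1 hge]⟩
      simp [J, hk0 _ this]
    · simp [J, hz _ ht]
  have hJΩ : ∀ p : ℝ × ℝ, p ∉ Ω → J p = 0 := fun p hp => hJ0 p fun hm =>
    hp ⟨⟨h0.trans_le hm.1.1, hm.1.2.trans_lt (by rw [hT]; linarith)⟩, hm.2⟩
  obtain ⟨Ck, hCk⟩ : ∃ Ck, ∀ r, |k r| ≤ Ck :=
    (HasCompactSupport.of_support_subset_isCompact (isCompact_Icc (a := (0 : ℝ)) (b := 1))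
      fun r hr => by
        by_contra hne
        exact hr (hk0 r fun hm => hne (Ioo_subset_Icc_self hm))).exists_bound_of_continuous hk
  have hJb : ∀ p, |J p| ≤ M * t1 / t0 * Ck := fun p => by
    have hCk0 : 0 ≤ Ck := (abs_nonneg _).trans (hCk 0)
    by_cases ht : p.1 ∈ Icc t0 t1
    · simp only [J]
      rw [abs_mul, abs_div, abs_mul, abs_of_pos ht1, abs_of_pos (h0.trans_le ht.1)]
      refine mul_le_mul ?_ (hCk _) (abs_nonneg _) (by positivity)
      exact div_le_div₀ (by positivity) (mul_le_mul_of_nonneg_right (hM _) ht1.le) h0 ht.1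
    · rw [hJ0 p fun hm => ht hm.1, abs_zero]
      positivity
  let W : ℕ → ℝ × ℝ → State := fun n p => u p.1 (v * p.1 + κ n * p.2)
  let Y : ℕ → ℝ × ℝ → ℝ := fun n p => (v * p.1 + κ n * p.2) / p.1
  have hGm : AEStronglyMeasurable (fun p : ℝ × ℝ => G (u p.1 p.2) (p.2 / p.1))
      (volume.restrict halfPlane) :=
    hG.aestronglyMeasurable_comp (hu.prodMk measurable_ratio.aestronglyMeasurable)
      (huV.mono fun p hp => ⟨hp, mem_univ _⟩)
  have hstep : ∀ n : ℕ, ∫ p in halfPlane, fanTest (fun t => φ t / t)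
      (fun y => σ * (((n + 1 : ℕ) : ℝ) * t1) * k (σ * (((n + 1 : ℕ) : ℝ) * t1) * (y - v))) p *
        G (u p.1 p.2) (p.2 / p.1) = σ * ∫ p in Ω, J p * G (W n p) (Y n p) := fun n => by
    have hn : (0 : ℝ) < ((n + 1 : ℕ) : ℝ) := by positivity
    have hm1 : AEStronglyMeasurable (fun p => fanTest (fun t => φ t / t) (fun y =>
        σ * (((n + 1 : ℕ) : ℝ) * t1) * k (σ * (((n + 1 : ℕ) : ℝ) * t1) * (y - v))) p *
        G (u p.1 p.2) (p.2 / p.1)) (volume.restrict halfPlane) := by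
      refine (measurable_fanTest (hφ.measurable.div measurable_id) ?_).aestronglyMeasurable.mul hGm
      have := hk.measurable
      fun_prop
    rw [integral_comp_shear v (hκ n) hm1, ← integral_const_mul, ← integral_const_mul,
      ← setIntegral_eq_of_subset_of_forall_sdiff_eq_zero measurableSet_halfPlane hΩh
        (fun p hp => by rw [hJΩ p hp.2, zero_mul, mul_zero])]
    refine setIntegral_congr_fun measurableSet_halfPlane fun p hp => ?_
    have hp0 : p.1 ≠ 0 := ne_of_gt hp.1
    have e1 : σ * (((n + 1 : ℕ) : ℝ) * t1) * ((v * p.1 + κ n * p.2) / p.1 - v) =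
        t1 * p.2 / p.1 := by
      simp only [κ]
      field_simp
      linear_combination p.2 * hσ2
    have e2 : |κ n| = 1 / ((n + 1 : ℕ) : ℝ) := by
      simp only [κ]
      rw [abs_div, hσa, abs_of_pos hn]
    simp only [fanTest, W, Y, J]
    rw [e1, e2]
    field_simp
  simp_rw [hstep]
  refine Tendsto.const_mul σ ?_
  -- the limit integral
  have hlimit : ∫ t, φ t * G (w t) v = ∫ p in Ω, J p * G (w p.1) v := by
    have hwm : AEStronglyMeasurable (fun t => G (w t) v) (volume.restrict (Ioi 0)) :=
      hG.aestronglyMeasurable_comp (hw.prodMk aestronglyMeasurable_const)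
        (hwV.mono fun p hp => ⟨hp, mem_univ _⟩)
    have hint : Integrable (fun p : ℝ × ℝ => J p * G (w p.1) v)
        ((volume.restrict (Ioo 0 T)).prod (volume.restrict (Ioo 0 1))) := by
      have hm1 : AEStronglyMeasurable (fun p : ℝ × ℝ => G (w p.1) v)
          ((volume.restrict (Ioo 0 T)).prod (volume.restrict (Ioo 0 1))) :=
        (hwm.mono_measure (Measure.restrict_mono Ioo_subset_Ioi_self le_rfl)).comp_fst
      have hwV' : ∀ᵐ p : ℝ × ℝ ∂((volume.restrict (Ioo 0 T)).prod (volume.restrict (Ioo 0 1))),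
          w p.1 ∈ V0 := Measure.quasiMeasurePreserving_fst.ae
            (ae_mono (Measure.restrict_mono Ioo_subset_Ioi_self le_rfl) hwV)
      refine Integrable.of_bound (hJm.aestronglyMeasurable.mul hm1)
        (M * t1 / t0 * Ck * (C * (1 + |v|))) (hwV'.mono fun p hp => ?_)
      rw [Real.norm_eq_abs, abs_mul]
      exact mul_le_mul (hJb p) (hGC _ hp v) (abs_nonneg _) ((abs_nonneg _).trans (hJb p))
    rw [hΩ, volume_restrict_Ioo_prod, integral_prod _ hint,
      ← setIntegral_eq_integral_of_forall_compl_eq_zero (s := Ioo 0 T) (fun t ht => by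
        rw [hz t fun hm => ht ⟨h0.trans_le hm.1, hm.2.trans_lt (by rw [hT]; linarith)⟩, zero_mul])]
    refine setIntegral_congr_fun measurableSet_Ioo fun t ht => ?_
    simp only
    rw [integral_mul_const]
    congr 1
    by_cases ht' : t ∈ Icc t0 t1
    · rw [setIntegral_eq_integral_of_forall_compl_eq_zero (fun s hs => hJ0 (t, s) fun hm => hs hm.2)]
      simp only [J]
      rw [integral_const_mul]
      -- The kernel integrates to `t / t1` in `s`, which cancels the prefactor `t1 / t`.
      have e1 : (fun s => k (t1 * s / t)) = fun s => k (s / (t / t1)) := by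
        funext s
        congr 1
        field_simp
      rw [e1, Measure.integral_comp_div, hk1, abs_of_pos (div_pos ht.1 ht1)]
      have := ht.1.ne'
      simp only [smul_eq_mul, mul_one]
      field_simp
    · rw [hz t ht', integral_congr_ae (Eventually.of_forall fun s => hJ0 (t, s) fun hm => ht' hm.1),
        integral_zero]
  rw [hlimit]
  -- almost everywhere membership
  have hWV : ∀ᵐ p ∂(volume.restrict Ω), ∀ n, W n p ∈ V0 := ae_all_iff.2 fun n =>
    ae_mono (Measure.restrict_mono hΩh le_rfl) ((quasiMeasurePreserving_shear v (hκ n)).ae huV)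
  have hwV' : ∀ᵐ p ∂(volume.restrict Ω), w p.1 ∈ V0 := by
    rw [hΩ, volume_restrict_Ioo_prod]
    exact Measure.quasiMeasurePreserving_fst.ae
      (ae_mono (Measure.restrict_mono Ioo_subset_Ioi_self le_rfl) hwV)
  have hmeas := h.tendstoInMeasure hσ0 hu hw (T := T) (by rw [hT]; linarith)
  -- Convergence in measure gives convergence almost everywhere only along subsequences, which is
  -- enough since the limit is always the same.
  refine tendsto_of_subseq_tendsto fun ns hns => ?_
  obtain ⟨ms, hms, hae⟩ := (hmeas.comp hns).exists_seq_tendsto_ae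
  refine ⟨ms, tendsto_integral_of_dominated_convergence
    (fun _ => M * t1 / t0 * Ck * (C * (1 + (|v| + 1 / t0)))) (fun i => ?_) ?_ (fun i => ?_) ?_⟩
  · refine hJm.aestronglyMeasurable.mul ?_
    exact (hGm.comp_quasiMeasurePreserving
      (quasiMeasurePreserving_shear v (hκ _))).mono_measure (Measure.restrict_mono hΩh le_rfl)
  · refine integrableOn_const (ne_of_lt ?_)
    exact (measure_mono (Set.prod_mono Ioo_subset_Icc_self Ioo_subset_Icc_self)).trans_lt
      (isCompact_Icc.prod isCompact_Icc).measure_lt_top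
  · filter_upwards [hWV, ae_restrict_mem hΩm] with p hp hpΩ
    rw [Real.norm_eq_abs, abs_mul]
    by_cases ht : p.1 ∈ Icc t0 t1
    · refine mul_le_mul (hJb p) ((hGC _ (hp _) _).trans ?_) (abs_nonneg _)
        ((abs_nonneg _).trans (hJb p))
      have hp0 : 0 < p.1 := h0.trans_le ht.1
      have e1 : Y (ns (ms i)) p = v + κ (ns (ms i)) * (p.2 / p.1) := by
        simp only [Y]
        field_simp
      -- On the layer `|κ| ≤ 1`, `s < 1` and `t ≥ t0`, so the slopes `x/t` stay within `1 / t0` of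
      -- `v`.
      have e2 : |κ (ns (ms i)) * (p.2 / p.1)| ≤ 1 / t0 := by
        rw [abs_mul, abs_of_pos (div_pos hpΩ.2.1 hp0)]
        have := div_le_div₀ zero_le_one hpΩ.2.2.le h0 ht.1
        calc _ ≤ 1 * (1 / t0) := mul_le_mul (hκ1 _) this (div_nonneg hpΩ.2.1.le hp0.le) zero_le_one
          _ = _ := one_mul _
      rw [e1]
      gcongr
      exact (abs_add_le _ _).trans (add_le_add_right e2 _)
    · rw [hJ0 p fun hm => ht hm.1, abs_zero, zero_mul]
      have hCk0 : 0 ≤ Ck := (abs_nonneg _).trans (hCk 0)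
      positivity
  · filter_upwards [hae, hWV, hwV', ae_restrict_mem hΩm] with p hp hpV hpw hpΩ
    refine Tendsto.const_mul _ ?_
    have hp0 : p.1 ≠ 0 := hpΩ.1.1.ne'
    have hY : Tendsto (fun i => Y (ns (ms i)) p) atTop (𝓝 v) := by
      have h1 : Tendsto (fun n : ℕ => (v * p.1 + σ / ((n + 1 : ℕ) : ℝ) * p.2) / p.1) atTop
          (𝓝 ((v * p.1 + 0 * p.2) / p.1)) :=
        ((((tendsto_const_div_atTop_nhds_zero_nat σ).comp (tendsto_add_atTop_nat 1)).mul_const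
          p.2).const_add _).div_const _
      have e : (v * p.1 + 0 * p.2) / p.1 = v := by field_simp; ring
      rw [e] at h1
      exact h1.comp (hns.comp hms.tendsto_atTop)
    have h2 : Tendsto (fun i => (W (ns (ms i)) p, Y (ns (ms i)) p)) atTop
        (𝓝[V0 ×ˢ univ] (w p.1, v)) :=
      tendsto_nhdsWithin_iff.2 ⟨hp.prodMk_nhds hY,
        Eventually.of_forall fun i => ⟨hpV _, mem_univ _⟩⟩
    exact (hG (w p.1, v) ⟨hpw, mem_univ _⟩).tendsto.comp h2

end Trace

/-! ### Smooth cutoffs of the fan. -/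

section Cutoff

/-- A smooth step from `0` on `(-∞, 1/2]` to `1` on `[1, ∞)`. -/
def step (r : ℝ) : ℝ := Real.smoothTransition (2 * r - 1)

theorem contDiff_step : ContDiff ℝ ∞ step :=
  Real.smoothTransition.contDiff.comp ((contDiff_const.mul contDiff_id).sub contDiff_const)

theorem step_nonneg (r : ℝ) : 0 ≤ step r := Real.smoothTransition.nonneg _

theorem step_le_one (r : ℝ) : step r ≤ 1 := Real.smoothTransition.le_one _

theorem step_of_le {r : ℝ} (h : r ≤ 1 / 2) : step r = 0 :=
  Real.smoothTransition.zero_of_nonpos (by linarith)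

theorem step_of_ge {r : ℝ} (h : 1 ≤ r) : step r = 1 :=
  Real.smoothTransition.one_of_one_le (by linarith)

theorem continuous_deriv_step : Continuous (deriv step) := contDiff_step.continuous_deriv (by simp)

theorem hasDerivAt_step (r : ℝ) : HasDerivAt step (deriv step r) r :=
  (contDiff_step.differentiable (by simp) r).hasDerivAt

/-- To the left of `(0, 1)` the step is at its minimum `0`, to the right at its maximum `1`. -/
theorem deriv_step_eq_zero {r : ℝ} (h : r ∉ Ioo (0 : ℝ) 1) : deriv step r = 0 := by
  rcases le_or_gt r 0 with h0 | h0
  · refine IsLocalMin.deriv_eq_zero (Eventually.of_forall fun s => ?_)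
    rw [step_of_le (by linarith : r ≤ 1 / 2)]
    exact step_nonneg s
  · refine IsLocalMax.deriv_eq_zero (Eventually.of_forall fun s => ?_)
    rw [step_of_ge (not_lt.1 fun h1 => h ⟨h0, h1⟩)]
    exact step_le_one s

theorem hasCompactSupport_deriv_step : HasCompactSupport (deriv step) :=
  HasCompactSupport.of_support_subset_isCompact (isCompact_Icc (a := (0 : ℝ)) (b := 1))
    fun r hr => by
      by_contra hne
      exact hr (deriv_step_eq_zero fun hm => hne (Ioo_subset_Icc_self hm))

theorem integral_deriv_step : ∫ r, deriv step r = 1 := by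
  have h0 : Tendsto step atBot (𝓝 0) := tendsto_const_nhds.congr' (by
    filter_upwards [eventually_le_atBot (1 / 2 : ℝ)] with r hr using (step_of_le hr).symm)
  have h1 : Tendsto step atTop (𝓝 1) := tendsto_const_nhds.congr' (by
    filter_upwards [eventually_ge_atTop (1 : ℝ)] with r hr using (step_of_ge hr).symm)
  rw [integral_of_hasDerivAt_of_tendsto hasDerivAt_step
    (continuous_deriv_step.integrable_of_hasCompactSupport hasCompactSupport_deriv_step) h0 h1,
    sub_zero]

/-- A smooth cutoff of the interval `(vL, vR)`, with layers of width `1/m` at the end points. -/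
def fanCutoff (vL vR m y : ℝ) : ℝ := step (m * (y - vL)) * step (m * (vR - y))

variable {vL vR m : ℝ}

theorem contDiff_fanCutoff : ContDiff ℝ ∞ (fanCutoff vL vR m) :=
  (contDiff_step.comp (contDiff_const.mul (contDiff_id.sub contDiff_const))).mul
    (contDiff_step.comp (contDiff_const.mul (contDiff_const.sub contDiff_id)))

theorem fanCutoff_nonneg (y : ℝ) : 0 ≤ fanCutoff vL vR m y := mul_nonneg (step_nonneg _) (step_nonneg _)

theorem fanCutoff_le_one (y : ℝ) : fanCutoff vL vR m y ≤ 1 :=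
  mul_le_one₀ (step_le_one _) (step_nonneg _) (step_le_one _)

/-- Since `step` vanishes up to `1/2`, the outer half of each layer is empty and the closed support
stays in the open interval. -/
theorem tsupport_fanCutoff_subset (hm : 0 < m) : tsupport (fanCutoff vL vR m) ⊆ Ioo vL vR := by
  have h : tsupport (fanCutoff vL vR m) ⊆ Icc (vL + 1 / (2 * m)) (vR - 1 / (2 * m)) := by
    refine closure_minimal (fun y hy => ?_) isClosed_Icc
    have h1 : (1 : ℝ) / 2 < m * (y - vL) := by
      by_contra hle
      exact left_ne_zero_of_mul hy (step_of_le (not_lt.1 hle))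
    have h2 : (1 : ℝ) / 2 < m * (vR - y) := by
      by_contra hle
      exact right_ne_zero_of_mul hy (step_of_le (not_lt.1 hle))
    have e : 1 / (2 * m) = 1 / 2 / m := by field_simp
    rw [← div_lt_iff₀' hm, ← e] at h1 h2
    constructor <;> linarith
  have hpos : 0 < 1 / (2 * m) := by positivity
  exact h.trans fun y hy => ⟨by linarith [hy.1], by linarith [hy.2]⟩

theorem fanCutoff_eq_zero (hm : 0 < m) {y : ℝ} (hy : y ∉ Ioo vL vR) : fanCutoff vL vR m y = 0 :=
  image_eq_zero_of_notMem_tsupport fun h => hy (tsupport_fanCutoff_subset hm h)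

theorem fanCutoff_eq_one {y : ℝ} (h1 : 1 ≤ m * (y - vL)) (h2 : 1 ≤ m * (vR - y)) :
    fanCutoff vL vR m y = 1 := by
  rw [fanCutoff, step_of_ge h1, step_of_ge h2, one_mul]

/-- For large `m` the two layers are disjoint: where one factor varies the other equals `1`. The
factors `1` and `-1` are the sides `σ` of the two edges in `HasMeanTrace.tendsto_integral`. -/
theorem deriv_fanCutoff (h2 : 2 ≤ m * (vR - vL)) (y : ℝ) :
    deriv (fanCutoff vL vR m) y =
      1 * m * deriv step (1 * m * (y - vL)) + -1 * m * deriv step (-1 * m * (y - vR)) := by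
  have d1 : HasDerivAt (fun y => step (m * (y - vL))) (deriv step (m * (y - vL)) * (m * 1)) y :=
    (hasDerivAt_step _).comp y (((hasDerivAt_id y).sub_const vL).const_mul m)
  have d2 : HasDerivAt (fun y => step (m * (vR - y))) (deriv step (m * (vR - y)) * (m * -1)) y :=
    (hasDerivAt_step _).comp y (((hasDerivAt_id y).const_sub vR).const_mul m)
  have e : -1 * m * (y - vR) = m * (vR - y) := by ring
  have a1 : deriv step (m * (y - vL)) * step (m * (vR - y)) = deriv step (m * (y - vL)) := by
    by_cases hr : m * (y - vL) ∈ Ioo (0 : ℝ) 1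
    · rw [step_of_ge (by linarith [hr.2]), mul_one]
    · rw [deriv_step_eq_zero hr, zero_mul]
  have a2 : deriv step (m * (vR - y)) * step (m * (y - vL)) = deriv step (m * (vR - y)) := by
    by_cases hr : m * (vR - y) ∈ Ioo (0 : ℝ) 1
    · rw [step_of_ge (by linarith [hr.2]), mul_one]
    · rw [deriv_step_eq_zero hr, zero_mul]
  have d : deriv (fanCutoff vL vR m) y = _ := (d1.mul d2).deriv
  rw [d, e, one_mul]
  linear_combination m * a1 - m * a2

end Cutoff

/-! ### Passage to the limit in the cutoff. -/

section Assembly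

/-- The flux across `x = y t` contains `y η(u|b)` and grows linearly in `y`; the weight `1 + |y|` is
moved into the compactly supported profile. -/
theorem integrable_fanTest_mul_of_growth {ψ A : ℝ → ℝ} {c : ℝ × ℝ → ℝ} {t0 t1 M K : ℝ}
    (hψ : Measurable ψ) (hA : Continuous A) (hAc : HasCompactSupport A)
    (h0 : 0 < t0) (hz : ∀ t, t ∉ Icc t0 t1 → ψ t = 0) (hM : ∀ t, t ∈ Icc t0 t1 → |ψ t| ≤ M)
    (hc : AEStronglyMeasurable c (volume.restrict halfPlane))
    (hcK : ∀ᵐ p ∂(volume.restrict halfPlane), |c p| ≤ K * (1 + |p.2 / p.1|)) :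
    Integrable (fun p => fanTest ψ A p * c p) (volume.restrict halfPlane) := by
  have hm : Measurable fun p : ℝ × ℝ => 1 + |p.2 / p.1| := by fun_prop
  have hpos : ∀ y : ℝ, 0 < 1 + |y| := fun y => by positivity
  have := integrable_fanTest_mul (A := fun y => (1 + |y|) * A y)
    (c := fun p => (1 + |p.2 / p.1|)⁻¹ * c p) (K := K) hψ
    ((continuous_const.add continuous_abs).mul hA) hAc.mul_left h0 hz hM
    (hm.inv.aestronglyMeasurable.mul hc) (hcK.mono fun p hp => by
      rw [abs_mul, abs_inv, abs_of_pos (hpos _), inv_mul_le_iff₀ (hpos _), mul_comm]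
      exact hp)
  refine this.congr (Eventually.of_forall fun p => ?_)
  have := (hpos (p.2 / p.1)).ne'
  simp only [fanTest]
  field_simp

theorem hasCompactSupport_comp_affine {k : ℝ → ℝ} (hk : HasCompactSupport k) {m : ℝ} (hm : m ≠ 0)
    (v : ℝ) : HasCompactSupport fun y => m * k (m * (y - v)) := by
  have h := hk.comp_homeomorph ((Homeomorph.subRight v).trans (Homeomorph.mulLeft₀ m hm))
  exact h.mul_left (f := fun _ => m)

theorem integrable_mul_of_ae_bounded {φ F : ℝ → ℝ} {C : ℝ} (hφ : Continuous φ)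
    (hφc : HasCompactSupport φ) (hs : tsupport φ ⊆ Ioi 0)
    (hF : AEStronglyMeasurable F (volume.restrict (Ioi 0)))
    (hC : ∀ᵐ t ∂(volume.restrict (Ioi (0 : ℝ))), |F t| ≤ C) : Integrable fun t => φ t * F t := by
  rw [← integrableOn_iff_integrable_of_support_subset (s := Ioi 0)
    (fun t ht => hs (subset_tsupport φ (left_ne_zero_of_mul ht)))]
  exact ((hφ.integrable_of_hasCompactSupport hφc).integrableOn).mul_bdd (c := C) hF hC

theorem locallyIntegrableOn_of_growth {F : ℝ → ℝ} {C D : ℝ} (hC0 : 0 ≤ C)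
    (hF : AEStronglyMeasurable F (volume.restrict (Ioi 0)))
    (hC : ∀ᵐ t ∂(volume.restrict (Ioi (0 : ℝ))), |F t| ≤ C * t + D) :
    LocallyIntegrableOn F (Ioi 0) := fun x hx => by
  refine ⟨Ioo 0 (x + 1), ?_, ?_⟩
  · filter_upwards [self_mem_nhdsWithin, nhdsWithin_le_nhds (Iio_mem_nhds (lt_add_one x))] with t h1 h2
      using ⟨h1, h2⟩
  · have hle : volume.restrict (Ioo 0 (x + 1)) ≤ volume.restrict (Ioi (0 : ℝ)) :=
      Measure.restrict_mono Ioo_subset_Ioi_self le_rfl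
    refine Integrable.of_bound (hF.mono_measure hle) (C * (x + 1) + D) ?_
    filter_upwards [ae_mono hle hC, ae_restrict_mem measurableSet_Ioo] with t ht htm
    exact ht.trans (add_le_add_left (mul_le_mul_of_nonneg_left htm.2.le hC0) D)

variable {V0 : Set State} {f : State → State} {η q : State → ℝ} {lam : Fin 2 → State → ℝ}
  {vL vR : ℝ} {b b' : ℝ → State} {u : ℝ → ℝ → State}

/-- The total relative entropy in the fan at time `t`. -/
def fanEntropy (η : State → ℝ) (vL vR : ℝ) (b : ℝ → State) (u : ℝ → ℝ → State) (t : ℝ) : ℝ :=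
  ∫ x in (vL * t)..(vR * t), relEntropy η (u t x) (b (x / t))

/-- The relative entropy flux through the line `x = y t`, for the state `a` next to it. -/
def fanFlux (f : State → State) (η q : State → ℝ) (b : ℝ → State) (a : State) (y : ℝ) : ℝ :=
  relFlux f η q a (b y) - y * relEntropy η a (b y)

theorem IsFanCurve.continuousOn_fanFlux (hb : IsFanCurve V0 f vL vR b b')
    (hsys : System V0 f η q lam) :
    ContinuousOn (fun p : State × ℝ => fanFlux f η q b p.1 p.2) (V0 ×ˢ univ) :=
  (hb.continuousOn_relFlux hsys).sub (continuousOn_snd.mul (hb.continuousOn_relEntropy hsys))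

theorem abs_fanFlux_le {C : ℝ} {a : State} {y : ℝ}
    (h : |relEntropy η a (b y)| ≤ C ∧ |relFlux f η q a (b y)| ≤ C) :
    |fanFlux f η q b a y| ≤ C * (1 + |y|) := by
  refine (abs_sub _ _).trans ?_
  rw [abs_mul, mul_add, mul_one, mul_comm C]
  exact add_le_add h.2 (mul_le_mul_of_nonneg_left h.1 (abs_nonneg _))

/-- Fubini: almost every time slice is measurable with values in `V0` almost everywhere, hence
bounded on a bounded interval. -/
theorem IsFanCurve.ae_integrable_relEntropy (hb : IsFanCurve V0 f vL vR b b')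
    (hsys : System V0 f η q lam)
    (hum : AEStronglyMeasurable (fun p : ℝ × ℝ => u p.1 p.2) (volume.restrict halfPlane))
    (huV : ∀ᵐ p : ℝ × ℝ ∂(volume.restrict halfPlane), u p.1 p.2 ∈ V0) {C : ℝ}
    (hC : ∀ a ∈ V0, ∀ y, |relEntropy η a (b y)| ≤ C) :
    ∀ᵐ t ∂(volume.restrict (Ioi (0 : ℝ))),
      IntervalIntegrable (fun x => relEntropy η (u t x) (b (x / t))) volume (vL * t) (vR * t) ∧
      ∀ᵐ x, |relEntropy η (u t x) (b (x / t))| ≤ C := by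
  have hm := aestronglyMeasurable_relEntropy_comp hb hsys hum
    measurable_ratio.aestronglyMeasurable huV
  rw [volume_restrict_halfPlane] at hm huV
  filter_upwards [hm.prodMk_left, Measure.ae_ae_of_ae_prod huV] with t h1 h2
  have h3 : ∀ᵐ x, |relEntropy η (u t x) (b (x / t))| ≤ C := h2.mono fun x hx => hC _ hx _
  refine ⟨?_, h3⟩
  rw [intervalIntegrable_iff]
  exact Measure.integrableOn_of_bounded (M := C) (by simp) h1 (ae_restrict_of_ae h3)

/-- The moving domain becomes a fixed indicator in `x/t`, the form in which the cutoffs converge. -/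
theorem fanEntropy_eq (hlt : vL < vR) {t : ℝ} (ht : 0 < t) :
    fanEntropy η vL vR b u t =
      ∫ x, (Ioo vL vR).indicator (fun _ => (1 : ℝ)) (x / t) * relEntropy η (u t x) (b (x / t)) := by
  rw [fanEntropy, intervalIntegral.integral_of_le (mul_le_mul_of_nonneg_right hlt.le ht.le),
    integral_Ioc_eq_integral_Ioo, ← integral_indicator measurableSet_Ioo]
  congr 1
  funext x
  by_cases hx : x ∈ Ioo (vL * t) (vR * t)
  · rw [indicator_of_mem hx, indicator_of_mem, one_mul]
    exact ⟨(lt_div_iff₀ ht).2 hx.1, (div_lt_iff₀ ht).2 hx.2⟩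
  · rw [indicator_of_notMem hx, indicator_of_notMem, zero_mul]
    exact fun h => hx ⟨(lt_div_iff₀ ht).1 h.1, (div_lt_iff₀ ht).1 h.2⟩

/-- The evolution of the relative entropy between a solution and a rarefaction wave, in the fan. -/
theorem IsFanCurve.distribDerivLE (hb : IsFanCurve V0 f vL vR b b') (hlt : vL < vR)
    (hsys : System V0 f η q lam) (hu : u ∈ weakSolutions V0 f η q) {uL uR : ℝ → State}
    (huLm : AEStronglyMeasurable uL (volume.restrict (Ioi 0)))
    (huRm : AEStronglyMeasurable uR (volume.restrict (Ioi 0)))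
    (huL : HasMeanTrace u vL 1 uL) (huR : HasMeanTrace u vR (-1) uR)
    (huLV : ∀ᵐ t ∂(volume.restrict (Ioi (0 : ℝ))), uL t ∈ V0)
    (huRV : ∀ᵐ t ∂(volume.restrict (Ioi (0 : ℝ))), uR t ∈ V0) :
    DistribDerivLE (fanEntropy η vL vR b u)
      (fun t => fanFlux f η q b (uL t) vL - fanFlux f η q b (uR t) vR) := by
  have hum : AEStronglyMeasurable (fun p : ℝ × ℝ => u p.1 p.2) (volume.restrict halfPlane) := hu.1
  have huV := hu.2.1
  obtain ⟨C, hC0, hC⟩ := hb.exists_bound hsys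
  have hrm := aestronglyMeasurable_relEntropy_comp hb hsys hum
    measurable_ratio.aestronglyMeasurable huV
  have hflux := hb.continuousOn_fanFlux hsys
  have hfluxC : ∀ a ∈ V0, ∀ y, |fanFlux f η q b a y| ≤ C * (1 + |y|) := fun a ha y =>
    abs_fanFlux_le (hC a ha y)
  have hLm : AEStronglyMeasurable (fun t => fanFlux f η q b (uL t) vL) (volume.restrict (Ioi 0)) :=
    hflux.aestronglyMeasurable_comp (huLm.prodMk aestronglyMeasurable_const)
      (huLV.mono fun p hp => ⟨hp, mem_univ _⟩)
  have hRm : AEStronglyMeasurable (fun t => fanFlux f η q b (uR t) vR) (volume.restrict (Ioi 0)) :=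
    hflux.aestronglyMeasurable_comp (huRm.prodMk aestronglyMeasurable_const)
      (huRV.mono fun p hp => ⟨hp, mem_univ _⟩)
  have hLC : ∀ᵐ t ∂(volume.restrict (Ioi (0 : ℝ))), |fanFlux f η q b (uL t) vL| ≤ C * (1 + |vL|) :=
    huLV.mono fun t ht => hfluxC _ ht _
  have hRC : ∀ᵐ t ∂(volume.restrict (Ioi (0 : ℝ))), |fanFlux f η q b (uR t) vR| ≤ C * (1 + |vR|) :=
    huRV.mono fun t ht => hfluxC _ ht _
  have hone : Measurable ((Ioo vL vR).indicator fun _ => (1 : ℝ)) :=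
    measurable_const.indicator measurableSet_Ioo
  refine ⟨?_, ?_, fun φ hφ hφc hs hφ0 => ?_⟩
  · refine locallyIntegrableOn_of_growth (C := C * (vR - vL)) (D := 0)
      (mul_nonneg hC0 (sub_nonneg.2 hlt.le)) ?_ ?_
    · have hm : AEStronglyMeasurable (fun p : ℝ × ℝ => (Ioo vL vR).indicator (fun _ => (1 : ℝ))
          (p.2 / p.1) * relEntropy η (u p.1 p.2) (b (p.2 / p.1)))
          ((volume.restrict (Ioi 0)).prod volume) := by
        rw [← volume_restrict_halfPlane]
        exact (hone.comp measurable_ratio).aestronglyMeasurable.mul hrm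
      refine hm.integral_prod_right'.congr ?_
      filter_upwards [ae_restrict_mem measurableSet_Ioi] with t ht
      exact (fanEntropy_eq hlt ht).symm
    · filter_upwards [hb.ae_integrable_relEntropy hsys hum huV fun a ha y => (hC a ha y).1,
        ae_restrict_mem measurableSet_Ioi] with t ht ht0
      have ht0 : 0 < t := ht0
      have := intervalIntegral.norm_integral_le_of_norm_le_const_ae
        (f := fun x => relEntropy η (u t x) (b (x / t))) (C := C) (a := vL * t) (b := vR * t) (ht.2.mono fun x hx _ => hx)
      rw [add_zero]
      refine this.trans_eq ?_
      rw [← sub_mul, abs_of_pos (mul_pos (sub_pos.2 hlt) ht0)]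
      ring
  · refine locallyIntegrableOn_of_growth (C := 0) (D := C * (1 + |vL|) + C * (1 + |vR|)) le_rfl
      (hLm.sub hRm) ?_
    filter_upwards [hLC, hRC] with t h1 h2
    rw [zero_mul, zero_add]
    exact (abs_sub _ _).trans (add_le_add h1 h2)
  obtain ⟨t0, t1, M, h0, h01, hM0, hz, hM⟩ := exists_bounds_of_test hφ hφc hs
  have ht1 : 0 < t1 := h0.trans h01
  -- At a time `t ≤ t1` a layer of width `1 / m n` in `x/t` has width at most `1 / (n + 1)` in `x`,
  -- as the trace limit requires.
  let m : ℕ → ℝ := fun n => ((n + 1 : ℕ) : ℝ) * t1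
  have hm : ∀ n, 0 < m n := fun n => by positivity
  have hmt : Tendsto m atTop atTop :=
    ((tendsto_natCast_atTop_atTop (R := ℝ)).comp (tendsto_add_atTop_nat 1)).atTop_mul_const ht1
  -- the right-hand side
  have hfm : AEStronglyMeasurable (fun p : ℝ × ℝ => fanFlux f η q b (u p.1 p.2) (p.2 / p.1))
      (volume.restrict halfPlane) :=
    hflux.aestronglyMeasurable_comp (hum.prodMk measurable_ratio.aestronglyMeasurable)
      (huV.mono fun p hp => ⟨hp, mem_univ _⟩)
  have hint : ∀ (v σ : ℝ) (n : ℕ), σ ≠ 0 → Integrable (fun p => fanTest (fun t => φ t / t)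
      (fun y => σ * m n * deriv step (σ * m n * (y - v))) p *
        fanFlux f η q b (u p.1 p.2) (p.2 / p.1)) (volume.restrict halfPlane) := fun v σ n hσ =>
    integrable_fanTest_mul_of_growth (t1 := t1) (M := M / t0) (K := C)
      (hφ.continuous.measurable.div measurable_id)
      (continuous_const.mul (continuous_deriv_step.comp (by fun_prop)))
      (hasCompactSupport_comp_affine hasCompactSupport_deriv_step (mul_ne_zero hσ (hm n).ne') v)
      h0 (fun t ht => by simp [(hz t ht).1])
      (fun t ht => by
        rw [abs_div, abs_of_pos (h0.trans_le ht.1)]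
        exact div_le_div₀ hM0 (hM _).1 h0 ht.1) hfm (huV.mono fun p hp => hfluxC _ hp _)
  have tL := huL.tendsto_integral (Or.inl rfl) hum huV huLm huLV hflux hC0 hfluxC hφ.continuous h0 h01
    (fun t ht => (hz t ht).1) (fun t => (hM t).1) continuous_deriv_step
    (fun _ hr => deriv_step_eq_zero hr) integral_deriv_step
  have tR := huR.tendsto_integral (Or.inr rfl) hum huV huRm huRV hflux hC0 hfluxC hφ.continuous h0 h01
    (fun t ht => (hz t ht).1) (fun t => (hM t).1) continuous_deriv_step
    (fun _ hr => deriv_step_eq_zero hr) integral_deriv_step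
  have hRHS : 1 * (∫ t, φ t * fanFlux f η q b (uL t) vL)
      + -1 * (∫ t, φ t * fanFlux f η q b (uR t) vR) =
      ∫ t, φ t * (fanFlux f η q b (uL t) vL - fanFlux f η q b (uR t) vR) := by
    simp_rw [mul_sub]
    rw [integral_sub (integrable_mul_of_ae_bounded hφ.continuous hφc hs hLm hLC)
      (integrable_mul_of_ae_bounded hφ.continuous hφc hs hRm hRC)]
    ring
  have tRHS : Tendsto (fun n => ∫ p in halfPlane, fanTest (fun t => φ t / t)
      (deriv (fanCutoff vL vR (m n))) p * fanFlux f η q b (u p.1 p.2) (p.2 / p.1)) atTop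
      (𝓝 (∫ t, φ t * (fanFlux f η q b (uL t) vL - fanFlux f η q b (uR t) vR))) := by
    rw [← hRHS]
    refine (tL.add tR).congr' ?_
    -- From this index on the two layers are disjoint and the derivative of the cutoff splits into
    -- its two edge kernels.
    filter_upwards [hmt.eventually_ge_atTop (2 / (vR - vL))] with n hn
    rw [div_le_iff₀ (sub_pos.2 hlt)] at hn
    rw [← integral_add (hint vL 1 n one_ne_zero) (hint vR (-1) n (by norm_num))]
    refine integral_congr_ae (Eventually.of_forall fun p => ?_)
    simp only [fanTest]
    rw [deriv_fanCutoff hn]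
    ring
  -- the left-hand side
  have hLHS : ∫ t, deriv φ t * fanEntropy η vL vR b u t =
      ∫ p in halfPlane, fanTest (deriv φ) ((Ioo vL vR).indicator fun _ => 1) p *
        relEntropy η (u p.1 p.2) (b (p.2 / p.1)) := by
    have hi : Integrable (fun p => fanTest (deriv φ) ((Ioo vL vR).indicator fun _ => 1) p *
        relEntropy η (u p.1 p.2) (b (p.2 / p.1))) (volume.restrict halfPlane) := by
      refine integrable_of_fanBox
        ((measurable_fanTest (measurable_deriv φ) hone).aestronglyMeasurable.mul hrm)
        (t0 := t0) (t1 := t1) (R := max |vL| |vR|) (C := M * 1 * C)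
        (huV.mono fun p hp => abs_fanTest_mul_le
          (c := fun p => relEntropy η (u p.1 p.2) (b (p.2 / p.1)))
          h0 (fun t ht => (hz t ht).2) (fun t _ => (hM t).2) (fun y hy => ?_) (fun y => ?_)
          (hC _ hp _).1)
      · exact indicator_of_notMem (fun h => hy.not_ge (abs_le_max_abs_abs h.1.le h.2.le)) _
      · by_cases hy : y ∈ Ioo vL vR <;> simp [hy]
    rw [volume_restrict_halfPlane] at hi ⊢
    rw [integral_prod _ hi, ← setIntegral_eq_integral_of_forall_compl_eq_zero (s := Ioi 0)
      (fun t ht => by rw [(hz t fun h => ht (h0.trans_le h.1)).2, zero_mul])]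
    refine setIntegral_congr_fun measurableSet_Ioi fun t ht => ?_
    simp only [fanTest, mul_assoc]
    rw [integral_const_mul, fanEntropy_eq hlt ht]
  have tLHS : Tendsto (fun n => ∫ p in halfPlane, fanTest (deriv φ) (fanCutoff vL vR (m n)) p *
      relEntropy η (u p.1 p.2) (b (p.2 / p.1))) atTop
      (𝓝 (∫ t, deriv φ t * fanEntropy η vL vR b u t)) := by
    rw [hLHS]
    refine tendsto_integral_of_dominated_convergence
      ((fanBox t0 t1 (max |vL| |vR|)).indicator fun _ => M * 1 * C) (fun n => ?_)
      (integrable_fanBox_indicator _ _ _ _) (fun n => ?_) (Eventually.of_forall fun p => ?_)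
    · exact (measurable_fanTest (measurable_deriv φ)
        contDiff_fanCutoff.continuous.measurable).aestronglyMeasurable.mul hrm
    · refine huV.mono fun p hp => abs_fanTest_mul_le
        (c := fun p => relEntropy η (u p.1 p.2) (b (p.2 / p.1))) h0 (fun t ht => (hz t ht).2)
        (fun t _ => (hM t).2) (fun y hy => ?_) (fun y => ?_) (hC _ hp _).1
      · exact fanCutoff_eq_zero (hm n) fun h => hy.not_ge (abs_le_max_abs_abs h.1.le h.2.le)
      · rw [abs_of_nonneg (fanCutoff_nonneg y)]
        exact fanCutoff_le_one y
    · refine Tendsto.mul_const _ (Tendsto.const_mul _ (tendsto_const_nhds.congr' ?_))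
      by_cases hy : p.2 / p.1 ∈ Ioo vL vR
      · rw [indicator_of_mem hy]
        filter_upwards [hmt.eventually_ge_atTop (1 / (p.2 / p.1 - vL)),
          hmt.eventually_ge_atTop (1 / (vR - p.2 / p.1))] with n h1 h2
        exact (fanCutoff_eq_one ((div_le_iff₀ (sub_pos.2 hy.1)).1 h1)
          ((div_le_iff₀ (sub_pos.2 hy.2)).1 h2)).symm
      · rw [indicator_of_notMem hy]
        exact Eventually.of_forall fun n => (fanCutoff_eq_zero (hm n) hy).symm
  -- The inequality holds for each cutoff, and both sides converge.
  exact le_of_tendsto_of_tendsto tLHS.neg tRHS (Eventually.of_forall fun n =>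
    hb.relEntropy_inequality hsys hu hφ hφc hs hφ0 contDiff_fanCutoff
      (tsupport_fanCutoff_subset (hm n)) fanCutoff_nonneg)

end Assembly

/-! ### Back from the extended profile to the rarefaction wave. -/

theorem IsRarefaction.relEntropy_IccExtend {V0 : Set State} {f : State → State} {η : State → ℝ}
    {lam : Fin 2 → State → ℝ} {i : Fin 2} {vL vR : ℝ} {ubar : ℝ → State}
    (h : IsRarefaction V0 f lam i vL vR ubar) (u : ℝ → ℝ → State) {t x : ℝ} (ht : 0 < t)
    (hx : x ∈ uIcc (vL * t) (vR * t)) :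
    relEntropy η (u t x) (IccExtend h.lt.le ((Icc vL vR).domRestrict ubar) (x / t)) =
      relEntropy η (u t x) (ubar (x / t)) := by
  rw [uIcc_of_le (mul_le_mul_of_nonneg_right h.lt.le ht.le)] at hx
  rw [IccExtend_of_mem _ _ (show x / t ∈ Icc vL vR from
    ⟨(le_div_iff₀ ht).2 hx.1, (div_le_iff₀ ht).2 hx.2⟩)]
  rfl

/-- Test functions live in `t > 0`, so values of `E` at other times are irrelevant; this matters
because `x/t` identifies the two profiles only there. -/
theorem DistribDerivLE.congr {E E' B B' : ℝ → ℝ} (h : DistribDerivLE E B)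
    (hE : EqOn E E' (Ioi 0)) (hB : B = B') : DistribDerivLE E' B' := by
  subst hB
  obtain ⟨h1, h2, h3⟩ := h
  refine ⟨fun x hx => ?_, h2, fun φ hφ hφc hs hφ0 => ?_⟩
  · obtain ⟨s, hs, hi⟩ := h1 x hx
    exact ⟨s ∩ Ioi 0, inter_mem hs self_mem_nhdsWithin, (hi.mono_set inter_subset_left).congr
      (ae_mono (Measure.restrict_mono inter_subset_right le_rfl)
        (ae_restrict_of_forall_mem measurableSet_Ioi fun t ht => hE ht))⟩
  · rw [← integral_congr_ae (Eventually.of_forall fun t => ?_)]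
    · exact h3 φ hφ hφc hs hφ0
    · by_cases ht : 0 < t
      · simp only [hE ht]
      · have : deriv φ t = 0 := by
          by_contra hne
          exact ht (hs (support_deriv_subset hne))
        simp only [this, zero_mul]

end ConsLaw

end

theorem lemma4p2 (V0 : Set ConsLaw.State) (f : ConsLaw.State → ConsLaw.State)
    (η q : ConsLaw.State → ℝ) (lam : Fin 2 → ConsLaw.State → ℝ)
    (hsys : ConsLaw.System V0 f η q lam)
    (i : Fin 2) (vL vR : ℝ) (ubar : ℝ → ConsLaw.State)
    (hubar : ConsLaw.IsRarefaction V0 f lam i vL vR ubar)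
    (u : ℝ → ℝ → ConsLaw.State) (hu : u ∈ ConsLaw.weakSolutions V0 f η q)
    (uL uR : ℝ → ConsLaw.State)
    (huL : ConsLaw.IsRightTrace u (fun t => vL * t) uL)
    (huR : ConsLaw.IsLeftTrace u (fun t => vR * t) uR)
    (huL_mem : ∀ᵐ t ∂(volume.restrict (Ioi (0 : ℝ))), uL t ∈ V0)
    (huR_mem : ∀ᵐ t ∂(volume.restrict (Ioi (0 : ℝ))), uR t ∈ V0) :
    (∀ᵐ t ∂(volume.restrict (Ioi (0 : ℝ))),
      IntervalIntegrable (fun x => ConsLaw.relEntropy η (u t x) (ubar (x / t))) volume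
        (vL * t) (vR * t)) ∧
    ConsLaw.DistribDerivLE
      (fun t => ∫ x in (vL * t)..(vR * t), ConsLaw.relEntropy η (u t x) (ubar (x / t)))
      (fun t => ConsLaw.relFlux f η q (uL t) (ubar vL) - ConsLaw.relFlux f η q (uR t) (ubar vR)
        - vL * ConsLaw.relEntropy η (uL t) (ubar vL)
        + vR * ConsLaw.relEntropy η (uR t) (ubar vR)) := by
  have hb := hubar.isFanCurve
  have hlt := hubar.lt
  have hu' := hu
  obtain ⟨hum, huV, -, -⟩ := hu'
  obtain ⟨C, -, hC⟩ := hb.exists_bound hsys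
  refine ⟨?_, ?_⟩
  · filter_upwards [hb.ae_integrable_relEntropy hsys hum huV fun a ha y => (hC a ha y).1,
      ae_restrict_mem measurableSet_Ioi] with t ht ht0
    exact ht.1.congr fun x hx => hubar.relEntropy_IccExtend u ht0 (uIoc_subset_uIcc hx)
  · refine (hb.distribDerivLE hlt hsys hu huL.1.1 huR.1.1 huL.hasMeanTrace huR.hasMeanTrace huL_mem
      huR_mem).congr (fun t ht => ?_) (funext fun t => ?_)
    · exact intervalIntegral.integral_congr fun x hx => hubar.relEntropy_IccExtend u ht hx
    · have eL : IccExtend hlt.le ((Icc vL vR).domRestrict ubar) vL = ubar vL :=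
        IccExtend_of_mem _ _ (left_mem_Icc.2 hlt.le)
      have eR : IccExtend hlt.le ((Icc vL vR).domRestrict ubar) vR = ubar vR :=
        IccExtend_of_mem _ _ (right_mem_Icc.2 hlt.le)
      simp only [ConsLaw.fanFlux, eL, eR]
      ring
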